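/- **Conventions.** $\mathcal S$ is the category of finite ordinals $\underline n=\{1,\dots,n\}$ and arbitrary functions. For $\varphi:\underline m\to\underline n$ in $\mathcal S$ and $i\in\underline n$, $\varepsilon_{\varphi,i}:\varphi^{-1}(i)\to\underline m$ is the unique monotone injection with image $\{j:\varphi(j)=i\}$; for $\psi:\underline\ell\to\underline m$, $\psi^\varphi_i:(\varphi\psi)^{-1}(i)\to\varphi^{-1}(i)$ is the restriction of $\psi$. We write $\varepsilon j$ for $\varepsilon_{\varphi,i}(j)$. The lax slice $\mathbf{Cat}/\!/\mathcal S$ has as objects the small categories $\mathcal C$ with a functor $|{-}|:\mathcal C\to\mathcal S$; a morphism $\mathcal C\to\mathcal C'$ is a functor $F$ with a natural transformation $\nu_X:|X|\to|FX|$. The *modified décalage comonad* $\mathsf D_m$ on $\mathbf{Cat}/\!/\mathcal S$ sends $(\mathcal C,|{-}|)$ to $D_m\mathcal C=\sum_{X\in\mathcal C,\,i\in|X|}\mathcal C/X$ with $|(X,i,f)|=|f|^{-1}(i)$ and $|g:(X,i,fg)\to(X,i,f)|=|g|^{|f|}_i$, and sends $(F,\nu)$ to $(X,i,f)\mapsto(FX,\nu_X(i),Ff)$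 with the restrictions $|f|^{-1}(i)\to|Ff|^{-1}(\nu_X(i))$ of $\nu_Y$ (for $f:Y\to X$). Its counit has functor $(X,i,f:Y\to X)\mapsto Y$ and $2$-cell $\varepsilon_{|f|,i}$. Its comultiplication sends the $(X,i)$-summand $\mathcal C/X$ to the summand of $D_mD_m\mathcal C$ indexed by $(X,i,1_X)$ and the unique element of $|1_X|^{-1}(i)$, through $\mathcal C/X\cong D_m\mathcal C/(X,i,1_X)$, with identity $2$-cell. A category *has local terminal objects* if each of its connected components has a chosen terminal object; $\tau_X:X\to uX$ is the map to the chosen terminal object of the component of $X$. The lax slice $\mathbf{Cat}_{\ell t}/\!/\mathcal S$ has as objects the $(\mathcal C,|{-}|)$ with local terminal objects such that $|uX|=\underline 1=\{*\}$ for all $X$, and as morphisms the morphisms $(F,\nu)$ of $\mathbf{Cat}/\!/\mathcal S$ for which $F$ strictly preserves chosen terminal objects. A *lax-operadic category* is an object $(\mathcal C,|{-}|)$ of $\mathbf{Cat}_{\ell t}/\!/\mathcal S$ with, for all $X\in\mathcal C$ and $i\in|X|$, a fibre functor $\mathcal C/X\to\mathcal C$, written $f\mapsto f^{-1}(i)$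 on objects and $(g:fg\to f)\mapsto(g^f_i:(fg)^{-1}(i)\to f^{-1}(i))$ on maps, and, for all $f:Y\to X$ and $i\in|X|$, a relabelling function $\gamma_{f,i}:|f|^{-1}(i)\to|f^{-1}(i)|$, such that (with $\gamma j=\gamma_{f,i}(j)$): * $(1_X)^{-1}(i)$ is a chosen terminal object; * $|g^f_i|\circ\gamma_{fg,i}=\gamma_{f,i}\circ|g|^{|f|}_i$; * $\tau_X^{-1}(*)=X$, $f^{\tau_X}_*=f$, and $\gamma_{\tau_X,*}$ is the identity of $|X|$; * for $j\in|f|^{-1}(i)$: $(g^f_i)^{-1}(\gamma j)=g^{-1}(\varepsilon j)$; moreover $\gamma_{g^f_i,\gamma j}\circ\bar\gamma_{fg,i}=\gamma_{g,\varepsilon j}$, where $\bar\gamma_{fg,i}:(|g|^{|f|}_i)^{-1}(j)=|g|^{-1}(\varepsilon j)\to|g^f_i|^{-1}(\gamma j)$ is the restriction of $\gamma_{fg,i}$; and $(h^{fg}_i)^{g^f_i}_{\gamma j}=h^g_{\varepsilon j}$ for every $h:fgh\to fg$ in $\mathcal C/X$. A *lax-operadic functor* is a morphism $(F,\nu)$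 of $\mathbf{Cat}_{\ell t}/\!/\mathcal S$ with $F(f^{-1}(i))=(Ff)^{-1}(\nu_X(i))$, $F(g^f_i)=(Fg)^{Ff}_{\nu_X(i)}$ and $\nu_{f^{-1}(i)}\circ\gamma_{f,i}=\gamma_{Ff,\nu_X(i)}\circ\nu_Y|$ for all $f:Y\to X$, $g:Z\to Y$ and $i\in|X|$, where $\nu_Y|:|f|^{-1}(i)\to|Ff|^{-1}(\nu_X(i))$ is the restriction of $\nu_Y$. These form the category $\mathbf{LaxOpCat}$. **Theorem 2.** The category $(\mathbf{Cat}/\!/\mathcal S)^{\mathsf D_m}$ of $\mathsf D_m$-coalgebras is isomorphic over $\mathbf{Cat}/\!/\mathcal S$ to $\mathbf{Cat}_{\ell t}/\!/\mathcal S$, the coalgebra structure of $(\mathcal C,|{-}|)$ being the morphism with functor $X\mapsto(uX,*,\tau_X)$ and identity $2$-cell. Let the *modified décalage monad* $\mathsf{\tilde D}_m$ on $\mathbf{Cat}_{\ell t}/\!/\mathcal S\cong(\mathbf{Cat}/\!/\mathcal S)^{\mathsf D_m}$ be the monad induced by the forgetful–cofree adjunction $(\mathbf{Cat}/\!/\mathcal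 S)^{\mathsf D_m}\leftrightarrows\mathbf{Cat}/\!/\mathcal S$. Then the category of $\mathsf{\tilde D}_m$-algebras is isomorphic, over $\mathbf{Cat}_{\ell t}/\!/\mathcal S$, to $\mathbf{LaxOpCat}$, the algebra structure $D_m(\mathcal C,|{-}|)\to(\mathcal C,|{-}|)$ of a lax-operadic category being the morphism with functor $(X,i,f)\mapsto f^{-1}(i)$, $g\mapsto g^f_i$, and $2$-cell $\gamma$. -/

import Mathlib

open CategoryTheory

universe u

namespace OperadicDecalage

/-! ### The category of finite ordinals and arbitrary maps -/

/-- An object of the category of finite ordinals: the ordinal with `len` elements. -/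
structure FinOrd : Type where
  len : ℕ

/-- The category `𝓢` of finite ordinals and arbitrary functions between them. -/
instance : SmallCategory FinOrd where
  Hom m n := Fin m.len → Fin n.len
  id _ := id
  comp f g := g ∘ f

/-- The set of elements over `i`. -/
def fibSet {m n : ℕ} (φ : Fin m → Fin n) (i : Fin n) : Finset (Fin m) :=
  Finset.univ.filter (fun j => φ j = i)

/-- The fibre `φ⁻¹(i)`, as a finite ordinal. -/
def fib {m n : ℕ} (φ : Fin m → Fin n) (i : Fin n) : ℕ :=
  (fibSet φ i).card

/-- The unique monotone injection `ε : φ⁻¹(i) → m` with image the set of elements over `i`. -/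
def eps {m n : ℕ} (φ : Fin m → Fin n) (i : Fin n) : Fin (fib φ i) → Fin m :=
  (fibSet φ i).orderEmbOfFin rfl

theorem apply_eps {m n : ℕ} (φ : Fin m → Fin n) (i : Fin n) (k : Fin (fib φ i)) :
    φ (eps φ i k) = i :=
  (Finset.mem_filter.mp ((fibSet φ i).orderEmbOfFin_mem rfl k)).2

theorem eps_strictMono {m n : ℕ} (φ : Fin m → Fin n) (i : Fin n) : StrictMono (eps φ i) :=
  ((fibSet φ i).orderEmbOfFin rfl).strictMono

theorem eps_injective {m n : ℕ} (φ : Fin m → Fin n) (i : Fin n) :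
    Function.Injective (eps φ i) :=
  (eps_strictMono φ i).injective

/-- The position in `φ⁻¹(i)` of an element `j` over `i`. -/
def pos {m n : ℕ} (φ : Fin m → Fin n) (i : Fin n) (j : Fin m) (h : φ j = i) :
    Fin (fib φ i) :=
  ((fibSet φ i).orderIsoOfFin rfl).symm ⟨j, Finset.mem_filter.mpr ⟨Finset.mem_univ _, h⟩⟩

@[simp]
theorem eps_pos {m n : ℕ} (φ : Fin m → Fin n) (i : Fin n) (j : Fin m) (h : φ j = i) :
    eps φ i (pos φ i j h) = j := by
  unfold eps pos
  rw [← Finset.coe_orderIsoOfFin_apply, OrderIso.apply_symm_apply]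

/-- If `a` sends elements over `i'` to elements over `i`, this is the unique function
`φ'⁻¹(i') → φ⁻¹(i)` with `ε ∘ restr = a ∘ ε`. -/
def restr {l m n n' : ℕ} (φ' : Fin l → Fin n') (i' : Fin n') (φ : Fin m → Fin n) (i : Fin n)
    (a : Fin l → Fin m) (h : ∀ x, φ' x = i' → φ (a x) = i) :
    Fin (fib φ' i') → Fin (fib φ i) :=
  fun k => pos φ i (a (eps φ' i' k)) (h _ (apply_eps φ' i' k))

@[simp]
theorem eps_restr {l m n n' : ℕ} (φ' : Fin l → Fin n') (i' : Fin n') (φ : Fin m → Fin n)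
    (i : Fin n) (a : Fin l → Fin m) (h : ∀ x, φ' x = i' → φ (a x) = i) (k : Fin (fib φ' i')) :
    eps φ i (restr φ' i' φ i a h k) = a (eps φ' i' k) :=
  eps_pos _ _ _ _

/-! ### The lax slice `Cat // 𝓢` -/

/-- An object of the lax slice: a small category with a functor to `𝓢`. -/
structure LaxSlice : Type (u + 1) where
  carrier : Type u
  [cat : SmallCategory carrier]
  card : carrier ⥤ FinOrd

attribute [instance] LaxSlice.cat

/-- The cardinality `|X|`. -/
def LaxSlice.abs (A : LaxSlice.{u}) (X : A.carrier) : ℕ := (A.card.obj X).len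

/-- The function `|f| : |Y| → |X|`. -/
def LaxSlice.absMap (A : LaxSlice.{u}) {Y X : A.carrier} (f : Y ⟶ X) :
    Fin (A.abs Y) → Fin (A.abs X) := A.card.map f

@[simp]
theorem LaxSlice.absMap_id (A : LaxSlice.{u}) (X : A.carrier) (j : Fin (A.abs X)) :
    A.absMap (𝟙 X) j = j :=
  congrFun (A.card.map_id X) j

@[simp]
theorem LaxSlice.absMap_comp (A : LaxSlice.{u}) {Z Y X : A.carrier} (g : Z ⟶ Y) (f : Y ⟶ X)
    (j : Fin (A.abs Z)) : A.absMap (g ≫ f) j = A.absMap f (A.absMap g j) :=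
  congrFun (A.card.map_comp g f) j

/-- A morphism of the lax slice: a functor `F` with a natural transformation
`ν : |-| ⇒ |F -|`. -/
structure LaxSlice.Hom (A B : LaxSlice.{u}) : Type u where
  F : A.carrier ⥤ B.carrier
  ν : A.card ⟶ F ⋙ B.card

/-- The component `ν_X : |X| → |F X|`. -/
def LaxSlice.Hom.rel {A B : LaxSlice.{u}} (α : LaxSlice.Hom A B) (X : A.carrier) :
    Fin (A.abs X) → Fin (B.abs (α.F.obj X)) := α.ν.app X

theorem LaxSlice.Hom.rel_naturality {A B : LaxSlice.{u}} (α : LaxSlice.Hom A B)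
    {Y X : A.carrier} (f : Y ⟶ X) (j : Fin (A.abs Y)) :
    B.absMap (α.F.map f) (α.rel Y j) = α.rel X (A.absMap f j) :=
  (congrFun (α.ν.naturality f) j).symm

/-- Construct a morphism of the lax slice from the components of its natural transformation. -/
def LaxSlice.Hom.ofRel {A B : LaxSlice.{u}} (F : A.carrier ⥤ B.carrier)
    (rel : ∀ X, Fin (A.abs X) → Fin (B.abs (F.obj X)))
    (nat : ∀ {Y X : A.carrier} (f : Y ⟶ X) (j : Fin (A.abs Y)),
      B.absMap (F.map f) (rel Y j) = rel X (A.absMap f j)) : LaxSlice.Hom A B where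
  F := F
  ν := { app := fun X => rel X
         naturality := fun _ _ f => funext fun j => (nat f j).symm }

theorem LaxSlice.Hom.ext' {A B : LaxSlice.{u}} {α β : LaxSlice.Hom A B}
    (hobj : ∀ X, α.F.obj X = β.F.obj X)
    (hmap : ∀ {Y X : A.carrier} (f : Y ⟶ X), HEq (α.F.map f) (β.F.map f))
    (hrel : ∀ X j, (α.rel X j).val = (β.rel X j).val) : α = β := by
  obtain ⟨F, ν⟩ := α
  obtain ⟨G, ν'⟩ := β
  have hFG : F = G := CategoryTheory.Functor.hext hobj (fun _ _ f => hmap f)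
  subst hFG
  congr 1
  ext X
  funext j
  exact Fin.ext (hrel X j)

/-- The lax slice category `Cat // 𝓢`. -/
instance : Category.{u} LaxSlice.{u} where
  Hom := LaxSlice.Hom
  id A := .ofRel (𝟭 A.carrier) (fun _ j => j) (fun _ _ => rfl)
  comp α β := .ofRel (α.F ⋙ β.F) (fun X j => β.rel _ (α.rel X j))
    (fun f j => (β.rel_naturality (α.F.map f) (α.rel _ j)).trans
      (congrArg _ (α.rel_naturality f j)))
  id_comp _ := rfl
  comp_id _ := rfl
  assoc _ _ _ := rfl

/-! ### The modified décalage comonad -/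

/-- An object `(X, i, f : Y ⟶ X)` of `D_m C = Σ_{X ∈ C, i ∈ |X|} C / X`. -/
structure DecObj (A : LaxSlice.{u}) : Type u where
  base : A.carrier
  idx : Fin (A.abs base)
  src : A.carrier
  hom : src ⟶ base

/-- A morphism of `D_m C = Σ_{X ∈ C, i ∈ |X|} C / X`: its codomain is some `(X, i, f)`, it is
given by a map `g` of `C` into the domain of `f`, and its domain is `(X, i, g ≫ f)`. -/
structure DecHom {A : LaxSlice.{u}} (p q : DecObj A) : Type u where
  left : p.src ⟶ q.src
  w : p = ⟨q.base, q.idx, p.src, left ≫ q.hom⟩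

theorem DecHom.ind {A : LaxSlice.{u}} {q : DecObj A} {motive : ∀ p : DecObj A, DecHom p q → Prop}
    (mk : ∀ {Z : A.carrier} (g : Z ⟶ q.src),
      motive ⟨q.base, q.idx, Z, g ≫ q.hom⟩ ⟨g, rfl⟩) {p : DecObj A} (a : DecHom p q) :
    motive p a := by
  obtain ⟨a, ha⟩ := a
  obtain ⟨X, i, Y, f⟩ := p
  dsimp only at a ha
  cases ha
  exact mk a

theorem DecHom.ext' {A : LaxSlice.{u}} {p q : DecObj A} {a b : DecHom p q}
    (h : a.left = b.left) : a = b := by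
  cases a; cases b; cases h; rfl

theorem DecHom.hext {A : LaxSlice.{u}} {p q p' q' : DecObj A} (hp : p = p') (hq : q = q')
    {a : DecHom p q} {b : DecHom p' q'} (h : HEq a.left b.left) : HEq a b := by
  subst hp hq
  exact heq_of_eq (DecHom.ext' (eq_of_heq h))

instance (A : LaxSlice.{u}) : SmallCategory (DecObj A) where
  Hom := DecHom
  id p := ⟨𝟙 _, by simp⟩
  comp {p q r} a b := ⟨a.left ≫ b.left, by
    induction b using DecHom.ind
    induction a using DecHom.ind
    simp⟩
  id_comp _ := DecHom.ext' (Category.id_comp _)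
  comp_id _ := DecHom.ext' (Category.comp_id _)
  assoc _ _ _ := DecHom.ext' (Category.assoc _ _ _)

@[simp]
theorem DecObj.id_left {A : LaxSlice.{u}} (p : DecObj A) : DecHom.left (𝟙 p) = 𝟙 p.src := rfl

@[simp]
theorem DecObj.comp_left {A : LaxSlice.{u}} {p q r : DecObj A} (a : p ⟶ q) (b : q ⟶ r) :
    DecHom.left (a ≫ b) = DecHom.left a ≫ DecHom.left b := rfl

theorem DecHom.over {A : LaxSlice.{u}} {p q : DecObj A} (a : DecHom p q)
    (x : Fin (A.abs p.src)) (hx : A.absMap p.hom x = p.idx) :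
    A.absMap q.hom (A.absMap a.left x) = q.idx := by
  induction a using DecHom.ind
  simpa using hx

/-- The modified décalage `(D_m C, |-|)` of `(C, |-|)`: the cardinality of `(X, i, f)` is the
fibre `|f|⁻¹(i)`, and that of a map is the induced map of fibres. -/
abbrev decObj (A : LaxSlice.{u}) : LaxSlice.{u} where
  carrier := DecObj A
  card :=
    { obj := fun p => ⟨fib (A.absMap p.hom) p.idx⟩
      map := fun {p q} a => restr (A.absMap p.hom) p.idx (A.absMap q.hom) q.idx
        (A.absMap (DecHom.left a)) (DecHom.over a)
      map_id := fun p => funext fun k => eps_injective _ _ (by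
        rw [eps_restr]; exact A.absMap_id _ _)
      map_comp := fun a b => funext fun k => eps_injective _ _ (by
        rw [eps_restr]
        refine (A.absMap_comp _ _ _).trans ?_
        exact ((eps_restr _ _ _ _ _ (DecHom.over b) _).trans
          (congrArg _ (eps_restr _ _ _ _ _ (DecHom.over a) _))).symm) }

/-- `ε` for an object of `D_m C`. -/
def DecObj.eps {A : LaxSlice.{u}} (p : DecObj A) :
    Fin ((decObj A).abs p) → Fin (A.abs p.src) :=
  OperadicDecalage.eps (A.absMap p.hom) p.idx

theorem DecObj.eps_injective {A : LaxSlice.{u}} (p : DecObj A) : Function.Injective p.eps :=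
  OperadicDecalage.eps_injective _ _

@[simp]
theorem DecObj.eps_absMap {A : LaxSlice.{u}} {p q : DecObj A} (a : p ⟶ q)
    (k : Fin ((decObj A).abs p)) :
    q.eps ((decObj A).absMap a k) = A.absMap (DecHom.left a) (p.eps k) :=
  eps_restr _ _ _ _ _ (DecHom.over a) _

theorem DecObj.val_eq {A : LaxSlice.{u}} {p q : DecObj A} (h : p = q)
    {x : Fin ((decObj A).abs p)} {y : Fin ((decObj A).abs q)}
    (hxy : (p.eps x).val = (q.eps y).val) : x.val = y.val := by
  subst h
  exact congrArg Fin.val (p.eps_injective (Fin.ext hxy))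

/-- The functor `D_m F : (X, i, f) ↦ (F X, ν_X i, F f)`. -/
def decFunctor {A B : LaxSlice.{u}} (α : A ⟶ B) : DecObj A ⥤ DecObj B where
  obj p := ⟨α.F.obj p.base, α.rel p.base p.idx, α.F.obj p.src, α.F.map p.hom⟩
  map {p q} a := ⟨α.F.map (DecHom.left a), by
    induction a using DecHom.ind
    simp⟩
  map_id p := DecHom.ext' (α.F.map_id _)
  map_comp a b := DecHom.ext' (α.F.map_comp _ _)

theorem LaxSlice.Hom.over {A B : LaxSlice.{u}} (α : A ⟶ B) (p : DecObj A)
    (x : Fin (A.abs p.src)) (hx : A.absMap p.hom x = p.idx) :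
    B.absMap (α.F.map p.hom) (α.rel p.src x) = α.rel p.base p.idx := by
  rw [α.rel_naturality, hx]

/-- The action of modified décalage on morphisms; the component of `D_m ν` at `(X, i, f : Y ⟶ X)`
is the restriction `|f|⁻¹(i) → |F f|⁻¹(ν_X i)` of `ν_Y`. -/
def decMap {A B : LaxSlice.{u}} (α : A ⟶ B) : decObj A ⟶ decObj B :=
  .ofRel (A := decObj A) (B := decObj B) (decFunctor α)
    (fun p => restr (A.absMap p.hom) p.idx (B.absMap (α.F.map p.hom)) (α.rel p.base p.idx)
      (α.rel p.src) (LaxSlice.Hom.over α p))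
    (fun {p q} a k => ((decFunctor α).obj q).eps_injective (by
      refine (DecObj.eps_absMap ((decFunctor α).map a) _).trans ?_
      refine (congrArg _ (eps_restr _ _ _ _ _ (LaxSlice.Hom.over α p) _)).trans ?_
      refine (α.rel_naturality _ _).trans ?_
      refine Eq.trans ?_ (eps_restr _ _ _ _ _ (LaxSlice.Hom.over α q) _).symm
      exact congrArg _ (DecObj.eps_absMap a k).symm))

@[simp]
theorem eps_decMap_rel {A B : LaxSlice.{u}} (α : A ⟶ B) (p : DecObj A)
    (k : Fin ((decObj A).abs p)) :
    ((decFunctor α).obj p).eps ((decMap α).rel p k) = α.rel p.src (p.eps k) :=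
  eps_restr _ _ _ _ _ (LaxSlice.Hom.over α p) _

/-- The counit `D_m C ⟶ C`, given by the slice projections `(X, i, f : Y ⟶ X) ↦ Y` and the
monotone injections `ε : |f|⁻¹(i) → |Y|`. -/
def decCounit (A : LaxSlice.{u}) : decObj A ⟶ A :=
  .ofRel (A := decObj A) (B := A)
    { obj := fun p => p.src, map := fun a => DecHom.left a }
    (fun p => p.eps) (fun a k => (DecObj.eps_absMap a k).symm)

/-- The object `(X, i, 1_X)` of `D_m C`. -/
def DecObj.one {A : LaxSlice.{u}} (X : A.carrier) (i : Fin (A.abs X)) : DecObj A :=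
  ⟨X, i, X, 𝟙 X⟩

/-- The unique element of `|1_X|⁻¹(i)`. -/
def DecObj.pt {A : LaxSlice.{u}} (X : A.carrier) (i : Fin (A.abs X)) :
    Fin ((decObj A).abs (DecObj.one X i)) :=
  pos (A.absMap (𝟙 X)) i i (A.absMap_id X i)

@[simp]
theorem DecObj.eps_pt {A : LaxSlice.{u}} (X : A.carrier) (i : Fin (A.abs X)) :
    (DecObj.one X i).eps (DecObj.pt X i) = i :=
  eps_pos _ _ _ _

/-- The functor `D_m C ⥤ D_m D_m C` sending the `(X, i)`-summand `C / X` to the summand of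
`(X, i, 1_X)` through the isomorphism `C / X ≅ D_m C / (X, i, 1_X)`. -/
def decComultFunctor (A : LaxSlice.{u}) : DecObj A ⥤ DecObj (decObj A) where
  obj p := ⟨DecObj.one p.base p.idx, DecObj.pt p.base p.idx, p, ⟨p.hom, by simp [DecObj.one]⟩⟩
  map {p q} a := ⟨a, by
    induction a using DecHom.ind
    rfl⟩
  map_id _ := rfl
  map_comp _ _ := rfl

theorem DecObj.over_pt {A : LaxSlice.{u}} (p : DecObj A) (k : Fin ((decObj A).abs p)) :
    (decObj A).absMap ((decComultFunctor A).obj p).hom k = DecObj.pt p.base p.idx :=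
  DecObj.eps_injective _ (by
    refine (DecObj.eps_absMap ((decComultFunctor A).obj p).hom k).trans ?_
    refine Eq.trans ?_ (DecObj.eps_pt _ _).symm
    exact apply_eps _ _ k)

/-- The comultiplication `D_m C ⟶ D_m D_m C`. The component of its natural transformation at
`p = (X, i, f)` is the identification of `|f|⁻¹(i)` with the fibre, over the unique element of
`|1_X|⁻¹(i)`, of the function `|f|⁻¹(i) → |1_X|⁻¹(i)`. -/
def decComult (A : LaxSlice.{u}) : decObj A ⟶ decObj (decObj A) :=
  .ofRel (A := decObj A) (B := decObj (decObj A)) (decComultFunctor A)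
    (fun p k => pos ((decObj A).absMap ((decComultFunctor A).obj p).hom)
      (DecObj.pt p.base p.idx) k (p.over_pt k))
    (fun {p q} a k => ((decComultFunctor A).obj q).eps_injective (by
      refine (DecObj.eps_absMap ((decComultFunctor A).map a) _).trans ?_
      refine (congrArg _ (eps_pos _ _ _ (p.over_pt k))).trans ?_
      exact (eps_pos _ _ _ (q.over_pt _)).symm))

@[simp]
theorem eps_decComult_rel {A : LaxSlice.{u}} (p : DecObj A) (k : Fin ((decObj A).abs p)) :
    ((decComultFunctor A).obj p).eps ((decComult A).rel p k) = k :=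
  eps_pos _ _ _ (p.over_pt k)

theorem DecObj.ext2 {A : LaxSlice.{u}} {P Q : DecObj (decObj A)} (hb : P.base = Q.base)
    (hi : (P.base.eps P.idx).val = (Q.base.eps Q.idx).val) (hs : P.src = Q.src)
    (hh : HEq (DecHom.left P.hom) (DecHom.left Q.hom)) : P = Q := by
  obtain ⟨b, i, s, h⟩ := P
  obtain ⟨b', i', s', h'⟩ := Q
  dsimp only at hb hs
  subst hb hs
  have hi' : i = i' := Fin.ext (DecObj.val_eq rfl hi)
  have hh' : h = h' := DecHom.ext' (eq_of_heq hh)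
  subst hi' hh'
  rfl

/-- The modified décalage comonad `D_m` on the lax slice `Cat // 𝓢`. -/
def modifiedDecalage : Comonad LaxSlice.{u} where
  obj := decObj
  map := decMap
  map_id A := by
    refine LaxSlice.Hom.ext' (fun p => rfl) (fun f => HEq.rfl) (fun p k => ?_)
    refine DecObj.val_eq rfl ?_
    exact congrArg Fin.val (eps_decMap_rel (𝟙 A) p k)
  map_comp {A B C} α β := by
    refine LaxSlice.Hom.ext' (fun p => rfl) (fun f => HEq.rfl) (fun p k => ?_)
    refine DecObj.val_eq rfl ?_
    have h1 := eps_decMap_rel β ((decFunctor α).obj p) ((decMap α).rel p k)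
    rw [eps_decMap_rel α p k] at h1
    exact congrArg Fin.val ((eps_decMap_rel (α ≫ β) p k).trans h1.symm)
  ε :=
    { app := decCounit
      naturality := fun A B α => by
        refine LaxSlice.Hom.ext' (fun p => rfl) (fun f => HEq.rfl) (fun p k => ?_)
        exact congrArg Fin.val (eps_decMap_rel α p k) }
  δ :=
    { app := decComult
      naturality := fun A B α => by
        have hobj : ∀ p : DecObj A, (decComultFunctor B).obj ((decFunctor α).obj p) =
            (decFunctor (decMap α)).obj ((decComultFunctor A).obj p) := fun p => by
          have hb : DecObj.one (α.F.obj p.base) (α.rel p.base p.idx) =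
              (decFunctor α).obj (DecObj.one p.base p.idx) := by
            simp [DecObj.one, decFunctor]
          refine DecObj.ext2 hb ?_ rfl HEq.rfl
          refine congrArg Fin.val ((DecObj.eps_pt _ _).trans ?_)
          exact ((eps_decMap_rel α (DecObj.one p.base p.idx) (DecObj.pt p.base p.idx)).trans
            (congrArg _ (DecObj.eps_pt _ _))).symm
        refine LaxSlice.Hom.ext' hobj
          (fun f => DecHom.hext (hobj _) (hobj _) HEq.rfl) (fun p k => ?_)
        refine DecObj.val_eq (hobj p) ?_
        have h1 := eps_decComult_rel ((decFunctor α).obj p) ((decMap α).rel p k)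
        have h2 := eps_decMap_rel (decMap α) ((decComultFunctor A).obj p) ((decComult A).rel p k)
        rw [eps_decComult_rel p k] at h2
        exact congrArg Fin.val (h1.trans h2.symm) }
  coassoc A := by
    have hobj : ∀ p : DecObj A,
        (decFunctor (decComult A)).obj ((decComultFunctor A).obj p) =
          (decComultFunctor (decObj A)).obj ((decComultFunctor A).obj p) := fun p => by
      refine DecObj.ext2 rfl ?_ rfl HEq.rfl
      refine congrArg Fin.val (Eq.trans ?_ (DecObj.eps_pt _ _).symm)
      exact eps_decComult_rel (DecObj.one p.base p.idx) (DecObj.pt p.base p.idx)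
    refine LaxSlice.Hom.ext' hobj
      (fun f => DecHom.hext (hobj _) (hobj _) HEq.rfl) (fun p k => ?_)
    refine DecObj.val_eq (hobj p) ?_
    have h1 := eps_decComult_rel ((decComultFunctor A).obj p) ((decComult A).rel p k)
    have h2 := eps_decMap_rel (decComult A) ((decComultFunctor A).obj p) ((decComult A).rel p k)
    rw [eps_decComult_rel p k] at h2
    refine congrArg Fin.val (Eq.trans h2 h1.symm)
  left_counit A := by
    refine LaxSlice.Hom.ext' (fun p => rfl) (fun f => HEq.rfl) (fun p k => ?_)
    exact congrArg Fin.val (eps_decComult_rel p k)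
  right_counit A := by
    have hobj : ∀ p : DecObj A,
        (decFunctor (decCounit A)).obj ((decComultFunctor A).obj p) = p := fun p =>
      congrArg (fun i => (⟨p.base, i, p.src, p.hom⟩ : DecObj A)) (DecObj.eps_pt p.base p.idx)
    refine LaxSlice.Hom.ext' hobj
      (fun f => DecHom.hext (hobj _) (hobj _) HEq.rfl) (fun p k => ?_)
    refine DecObj.val_eq (hobj p) ?_
    have h2 := eps_decMap_rel (decCounit A) ((decComultFunctor A).obj p) ((decComult A).rel p k)
    rw [eps_decComult_rel p k] at h2
    exact congrArg Fin.val h2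

/-- The modified décalage monad `D̃_m` on `(Cat // 𝓢)^{D_m}`: the monad induced by the
forgetful-cofree adjunction between `D_m`-coalgebras and `Cat // 𝓢`. -/
abbrev modifiedDecalageMonad : Monad modifiedDecalage.{u}.Coalgebra :=
  modifiedDecalage.{u}.adj.toMonad

/-! ### Local terminal objects -/

/-- A choice of a terminal object in each connected component of a category. -/
structure LocalTerminals (C : Type u) [SmallCategory C] : Type u where
  /-- The chosen object of each connected component. -/
  term : CategoryTheory.ConnectedComponents C → C
  /-- The map from `X` to the chosen object of its component. -/
  τ : ∀ X : C, X ⟶ term (CategoryTheory.ConnectedComponents.mk X)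
  uniq : ∀ {X : C} (f : X ⟶ term (CategoryTheory.ConnectedComponents.mk X)), f = τ X

/-- An object of `Cat_ℓt // 𝓢`: a small category with local terminal objects and a functor to `𝓢`
preserving local terminal objects, those of `𝓢` being given by its unique terminal object. -/
structure LtSlice : Type (u + 1) extends LaxSlice.{u} where
  lt : LocalTerminals carrier
  abs_term : ∀ c : CategoryTheory.ConnectedComponents carrier, toLaxSlice.abs (lt.term c) = 1

/-- The chosen terminal object `uX` in the component of `X`. -/
def LtSlice.uObj (A : LtSlice.{u}) (X : A.carrier) : A.carrier :=
  A.lt.term (CategoryTheory.ConnectedComponents.mk X)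

/-- The unique map `τ_X : X ⟶ uX`. -/
def LtSlice.τ (A : LtSlice.{u}) (X : A.carrier) : X ⟶ A.uObj X := A.lt.τ X

/-- The unique element `∗` of `|uX|`. -/
def LtSlice.star (A : LtSlice.{u}) (X : A.carrier) : Fin (A.abs (A.uObj X)) :=
  ⟨0, (A.abs_term _).symm ▸ Nat.one_pos⟩

theorem LtSlice.eq_star (A : LtSlice.{u}) (X : A.carrier) (j : Fin (A.abs (A.uObj X))) :
    j = A.star X :=
  Fin.ext (Nat.lt_one_iff.mp (lt_of_lt_of_eq j.isLt (A.abs_term _)))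

theorem LtSlice.unit_eq (A : LtSlice.{u}) {Y : A.carrier}
    (c : CategoryTheory.ConnectedComponents A.carrier)
    (hc : CategoryTheory.ConnectedComponents.mk Y = c) (i : Fin (A.abs (A.lt.term c)))
    (g : Y ⟶ A.lt.term c) :
    (⟨A.uObj Y, A.star Y, Y, A.τ Y⟩ : DecObj A.toLaxSlice) = ⟨A.lt.term c, i, Y, g⟩ := by
  subst hc
  rw [A.lt.uniq g, A.eq_star Y i]
  rfl

/-- An object is chosen terminal if it is the chosen object of some component. -/
def LtSlice.IsChosen (A : LtSlice.{u}) (X : A.carrier) : Prop :=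
  ∃ c : CategoryTheory.ConnectedComponents A.carrier, X = A.lt.term c

/-- A morphism of `Cat_ℓt // 𝓢`: a morphism of `Cat // 𝓢` whose functor strictly preserves the
chosen local terminal objects. -/
@[ext]
structure LtSlice.Hom (A B : LtSlice.{u}) : Type u where
  hom : A.toLaxSlice ⟶ B.toLaxSlice
  map_term : ∀ X : A.carrier, A.IsChosen X → B.IsChosen (hom.F.obj X)

/-- The lax slice category `Cat_ℓt // 𝓢`. -/
instance : Category.{u} LtSlice.{u} where
  Hom := LtSlice.Hom
  id A := ⟨𝟙 A.toLaxSlice, fun _ h => h⟩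
  comp α β := ⟨α.hom ≫ β.hom, fun _ h => β.map_term _ (α.map_term _ h)⟩
  id_comp _ := rfl
  comp_id _ := rfl
  assoc _ _ _ := rfl

/-- The forgetful functor `Cat_ℓt // 𝓢 ⥤ Cat // 𝓢`. -/
def LtSlice.forget : LtSlice.{u} ⥤ LaxSlice.{u} where
  obj A := A.toLaxSlice
  map α := α.hom

/-- The morphism `(C, |-|) ⟶ D_m (C, |-|)` with functor `X ↦ (uX, ∗, τ_X)`, `f ↦ f`, and with
natural transformation the identification of `|X|` with the fibre of `|τ_X| : |X| → |uX|`. -/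
def LtSlice.unit (A : LtSlice.{u}) : A.toLaxSlice ⟶ decObj A.toLaxSlice :=
  .ofRel (A := A.toLaxSlice) (B := decObj A.toLaxSlice)
    { obj := fun X => ⟨A.uObj X, A.star X, X, A.τ X⟩
      map := fun {Y X} f => ⟨f, A.unit_eq (CategoryTheory.ConnectedComponents.mk X)
        (Quotient.sound' (Zigzag.of_hom f)) _ _⟩
      map_id := fun _ => rfl
      map_comp := fun _ _ => rfl }
    (fun X j => pos (A.absMap (A.τ X)) (A.star X) j (A.eq_star X _))
    (fun {Y X} f j => by
      refine DecObj.eps_injective _ ?_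
      refine (DecObj.eps_absMap _ _).trans ?_
      refine (congrArg _ (eps_pos _ _ _ (A.eq_star Y _))).trans ?_
      exact (eps_pos _ _ _ (A.eq_star X _)).symm)

/-! ### Lax-operadic categories -/

/-- The data of a lax-operadic category. -/
structure LaxOpData : Type (u + 1) extends LtSlice.{u} where
  /-- The fibre functors `C / X ⥤ C`. -/
  fibreFunctor : ∀ (X : carrier) (_ : Fin (toLaxSlice.abs X)), Over X ⥤ carrier
  /-- The relabelling functions `γ_{f,i} : |f|⁻¹(i) → |f⁻¹(i)|`. -/
  relabel : ∀ {Y X : carrier} (f : Y ⟶ X) (i : Fin (toLaxSlice.abs X)),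
    Fin (fib (toLaxSlice.absMap f) i) → Fin (toLaxSlice.abs ((fibreFunctor X i).obj (Over.mk f)))

/-- The fibre `f⁻¹(i)`. -/
def LaxOpData.fibre (A : LaxOpData.{u}) {Y X : A.carrier} (f : Y ⟶ X) (i : Fin (A.abs X)) :
    A.carrier :=
  (A.fibreFunctor X i).obj (Over.mk f)

/-- The fibre map `g^f_i : (fg)⁻¹(i) ⟶ f⁻¹(i)` (the composite `fg` being written `g ≫ f`). -/
def LaxOpData.fibreMap (A : LaxOpData.{u}) {Z Y X : A.carrier} (f : Y ⟶ X) (g : Z ⟶ Y)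
    (i : Fin (A.abs X)) : A.fibre (g ≫ f) i ⟶ A.fibre f i :=
  (A.fibreFunctor X i).map (Over.homMk g : Over.mk (g ≫ f) ⟶ Over.mk f)

/-- The relabelling function `γ_{f,i} : |f|⁻¹(i) → |f⁻¹(i)|`. -/
def LaxOpData.γ (A : LaxOpData.{u}) {Y X : A.carrier} (f : Y ⟶ X) (i : Fin (A.abs X)) :
    Fin (fib (A.absMap f) i) → Fin (A.abs (A.fibre f i)) :=
  A.relabel f i

/-- The fibre map `|g|^{|f|}_i : |fg|⁻¹(i) → |f|⁻¹(i)` in `𝓢`. -/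
def LaxSlice.absFib (A : LaxSlice.{u}) {Z Y X : A.carrier} (f : Y ⟶ X) (g : Z ⟶ Y)
    (i : Fin (A.abs X)) : Fin (fib (A.absMap (g ≫ f)) i) → Fin (fib (A.absMap f) i) :=
  restr _ _ _ _ (A.absMap g) (fun x hx => (A.absMap_comp g f x).symm.trans hx)

/-- The equality `(|g|^{|f|}_i)⁻¹(j) = |g|⁻¹(ε j)` of objects of `𝓢`. -/
theorem LaxSlice.fib_absFib (A : LaxSlice.{u}) {Z Y X : A.carrier} (f : Y ⟶ X) (g : Z ⟶ Y)
    (i : Fin (A.abs X)) (j : Fin (fib (A.absMap f) i)) :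
    fib (A.absFib f g i) j = fib (A.absMap g) (eps (A.absMap f) i j) := by
  apply le_antisymm
  · have h : ∀ x, A.absFib f g i x = j →
        A.absMap g (eps (A.absMap (g ≫ f)) i x) = eps (A.absMap f) i j := fun x hx => by
      rw [← hx, LaxSlice.absFib, eps_restr]
    refine Fin.le_of_injective (restr (A.absFib f g i) j (A.absMap g) (eps (A.absMap f) i j)
      (eps (A.absMap (g ≫ f)) i) h) (fun x y hxy => ?_)
    have := congrArg (eps (A.absMap g) (eps (A.absMap f) i j)) hxy
    rw [eps_restr, eps_restr] at this
    exact eps_injective _ _ (eps_injective _ _ this)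
  · have h : ∀ x, A.absMap g x = eps (A.absMap f) i j → A.absMap (g ≫ f) x = i := fun x hx => by
      rw [A.absMap_comp, hx]
      exact apply_eps (A.absMap f) i j
    refine Fin.le_of_injective (fun k => pos (A.absFib f g i) j
      (pos (A.absMap (g ≫ f)) i (eps (A.absMap g) (eps (A.absMap f) i j) k)
        (h _ (apply_eps _ _ k))) (eps_injective _ _ ?_)) (fun x y hxy => ?_)
    · rw [LaxSlice.absFib, eps_restr, eps_pos]
      exact apply_eps (A.absMap g) (eps (A.absMap f) i j) k
    · have := congrArg (eps (A.absMap (g ≫ f)) i) (congrArg (eps (A.absFib f g i) j) hxy)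
      simp only [eps_pos] at this
      exact eps_injective _ _ this

/-- The function `γ̄_{fg,i} : (|g|^{|f|}_i)⁻¹(j) → |g^f_i|⁻¹(γ j)` obtained by restricting
`γ_{fg,i}`, which is possible by compatibility of fibre maps with relabelling. -/
def LaxOpData.γbar (A : LaxOpData.{u})
    (nat : ∀ {Z Y X : A.carrier} (f : Y ⟶ X) (g : Z ⟶ Y) (i : Fin (A.abs X))
      (k : Fin (fib (A.absMap (g ≫ f)) i)),
      A.absMap (A.fibreMap f g i) (A.γ (g ≫ f) i k) = A.γ f i (A.absFib f g i k))
    {Z Y X : A.carrier} (f : Y ⟶ X) (g : Z ⟶ Y) (i : Fin (A.abs X))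
    (j : Fin (fib (A.absMap f) i)) :
    Fin (fib (A.absFib f g i) j) →
      Fin (fib (A.absMap (A.fibreMap f g i)) (A.γ f i j)) :=
  restr _ _ _ _ (A.γ (g ≫ f) i) (fun x hx => (nat f g i x).trans (congrArg _ hx))

/-- A lax-operadic category. -/
structure LaxOpCat : Type (u + 1) extends LaxOpData.{u} where
  /-- The fibres of identities are chosen terminal. -/
  fib_id : ∀ (X : carrier) (i : Fin (toLaxSlice.abs X)),
    toLtSlice.IsChosen (toLaxOpData.fibre (𝟙 X) i)
  /-- Fibre maps are compatible with relabelling: `|g^f_i| ∘ γ_{fg,i} = γ_{f,i} ∘ |g|^{|f|}_i`. -/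
  abs_fibMap : ∀ {Z Y X : carrier} (f : Y ⟶ X) (g : Z ⟶ Y) (i : Fin (toLaxSlice.abs X))
    (k : Fin (fib (toLaxSlice.absMap (g ≫ f)) i)),
    toLaxSlice.absMap (toLaxOpData.fibreMap f g i) (toLaxOpData.γ (g ≫ f) i k) =
      toLaxOpData.γ f i (toLaxSlice.absFib f g i k)
  /-- `τ_X⁻¹(∗) = X`. -/
  fib_τ : ∀ X : carrier, toLaxOpData.fibre (toLtSlice.τ X) (toLtSlice.star X) = X
  /-- `f^{τ_X}_∗ = f`. -/
  fibMap_τ : ∀ {Y X : carrier} (f : Y ⟶ X),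
    HEq (toLaxOpData.fibreMap (toLtSlice.τ X) f (toLtSlice.star X)) f
  /-- `γ_{τ_X,∗} : |τ_X|⁻¹(∗) → |τ_X⁻¹(∗)|` is the identity function of `|X|`; here `|τ_X|⁻¹(∗) = |X|`
  by way of `ε`. -/
  γ_τ : ∀ (X : carrier) (k : Fin (fib (toLaxSlice.absMap (toLtSlice.τ X)) (toLtSlice.star X))),
    (toLaxOpData.γ (toLtSlice.τ X) (toLtSlice.star X) k).val =
      (eps (toLaxSlice.absMap (toLtSlice.τ X)) (toLtSlice.star X) k).val
  /-- `(g^f_i)⁻¹(γ j) = g⁻¹(ε j)`. -/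
  fib_fibMap : ∀ {Z Y X : carrier} (f : Y ⟶ X) (g : Z ⟶ Y) (i : Fin (toLaxSlice.abs X))
    (j : Fin (fib (toLaxSlice.absMap f) i)),
    toLaxOpData.fibre (toLaxOpData.fibreMap f g i) (toLaxOpData.γ f i j) =
      toLaxOpData.fibre g (eps (toLaxSlice.absMap f) i j)
  /-- `γ_{g^f_i, γ j} ∘ γ̄_{fg,i} = γ_{g, ε j}` as functions on
  `(|g|^{|f|}_i)⁻¹(j) = |g|⁻¹(ε j)`. -/
  γ_fibMap : ∀ {Z Y X : carrier} (f : Y ⟶ X) (g : Z ⟶ Y) (i : Fin (toLaxSlice.abs X))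
    (j : Fin (fib (toLaxSlice.absMap f) i)) (k : Fin (fib (toLaxSlice.absFib f g i) j)),
    (toLaxOpData.γ (toLaxOpData.fibreMap f g i) (toLaxOpData.γ f i j)
        (toLaxOpData.γbar abs_fibMap f g i j k)).val =
      (toLaxOpData.γ g (eps (toLaxSlice.absMap f) i j)
        (Fin.cast (toLaxSlice.fib_absFib f g i j) k)).val
  /-- `(h^{fg}_i)^{g^f_i}_{γ j} = h^g_{ε j}`. -/
  fibMap_fibMap : ∀ {W Z Y X : carrier} (f : Y ⟶ X) (g : Z ⟶ Y) (h : W ⟶ Z)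
    (i : Fin (toLaxSlice.abs X)) (j : Fin (fib (toLaxSlice.absMap f) i)),
    HEq (toLaxOpData.fibreMap (toLaxOpData.fibreMap f g i) (toLaxOpData.fibreMap (g ≫ f) h i)
        (toLaxOpData.γ f i j))
      (toLaxOpData.fibreMap g h (eps (toLaxSlice.absMap f) i j))

/-- The function `|f|⁻¹(i) → |F f|⁻¹(ν_X i)` obtained by restricting `ν_Y`. -/
def LaxSlice.Hom.relFib {A B : LaxSlice.{u}} (α : LaxSlice.Hom A B) {Y X : A.carrier} (f : Y ⟶ X)
    (i : Fin (A.abs X)) :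
    Fin (fib (A.absMap f) i) → Fin (fib (B.absMap (α.F.map f)) (α.rel X i)) :=
  restr _ _ _ _ (α.rel Y) (fun x hx => (α.rel_naturality f x).trans (congrArg _ hx))

@[simp]
theorem LaxSlice.Hom.eps_relFib {A B : LaxSlice.{u}} (α : LaxSlice.Hom A B) {Y X : A.carrier}
    (f : Y ⟶ X) (i : Fin (A.abs X)) (k : Fin (fib (A.absMap f) i)) :
    eps (B.absMap (α.F.map f)) (α.rel X i) (α.relFib f i k) =
      α.rel Y (eps (A.absMap f) i k) :=
  eps_restr _ _ _ _ _ (fun x hx => (α.rel_naturality f x).trans (congrArg _ hx)) _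

/-- A lax-operadic functor. -/
@[ext]
structure LaxOpCat.Hom (A B : LaxOpCat.{u}) : Type u where
  hom : A.toLtSlice ⟶ B.toLtSlice
  /-- `F (f⁻¹(i)) = (F f)⁻¹(ν_X i)`. -/
  map_fib : ∀ {Y X : A.carrier} (f : Y ⟶ X) (i : Fin (A.abs X)),
    hom.hom.F.obj (A.fibre f i) = B.fibre (hom.hom.F.map f) (hom.hom.rel X i)
  /-- `F (g^f_i) = (F g)^{F f}_{ν_X i}`. -/
  map_fibMap : ∀ {Z Y X : A.carrier} (f : Y ⟶ X) (g : Z ⟶ Y) (i : Fin (A.abs X)),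
    HEq (hom.hom.F.map (A.fibreMap f g i))
      (B.fibreMap (hom.hom.F.map f) (hom.hom.F.map g) (hom.hom.rel X i))
  /-- `ν_{f⁻¹(i)} ∘ γ_{f,i} = γ_{F f, ν_X i} ∘ ν_Y|`, where `ν_Y|` is the restriction
  `|f|⁻¹(i) → |F f|⁻¹(ν_X i)` of `ν_Y`. -/
  rel_γ : ∀ {Y X : A.carrier} (f : Y ⟶ X) (i : Fin (A.abs X))
    (k : Fin (fib (A.absMap f) i)),
    (hom.hom.rel (A.fibre f i) (A.γ f i k)).val =
      (B.γ (hom.hom.F.map f) (hom.hom.rel X i) (hom.hom.relFib f i k)).val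

theorem LaxSlice.Hom.map_heq {A B : LaxSlice.{u}} (α : LaxSlice.Hom A B)
    {X Y X' Y' : A.carrier} (hX : X = X') (hY : Y = Y') {f : X ⟶ Y} {f' : X' ⟶ Y'}
    (h : HEq f f') : HEq (α.F.map f) (α.F.map f') := by
  subst hX hY
  rw [eq_of_heq h]

theorem LaxSlice.Hom.rel_val {A B : LaxSlice.{u}} (α : LaxSlice.Hom A B) {X X' : A.carrier}
    (hX : X = X') {j : Fin (A.abs X)} {j' : Fin (A.abs X')} (h : j.val = j'.val) :
    (α.rel X j).val = (α.rel X' j').val := by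
  subst hX
  rw [Fin.ext h]

/-- The identity lax-operadic functor. -/
def LaxOpCat.Hom.id (A : LaxOpCat.{u}) : LaxOpCat.Hom A A where
  hom := 𝟙 A.toLtSlice
  map_fib := fun _ _ => rfl
  map_fibMap := fun _ _ _ => HEq.rfl
  rel_γ := fun f i k => congrArg (fun k' => (A.γ f i k').val)
    (eps_injective _ _ (LaxSlice.Hom.eps_relFib (𝟙 A.toLaxSlice) f i k).symm)

/-- The composite of lax-operadic functors. -/
def LaxOpCat.Hom.comp {A B C : LaxOpCat.{u}} (α : LaxOpCat.Hom A B) (β : LaxOpCat.Hom B C) :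
    LaxOpCat.Hom A C where
  hom := α.hom ≫ β.hom
  map_fib := fun f i => (congrArg β.hom.hom.F.obj (α.map_fib f i)).trans (β.map_fib _ _)
  map_fibMap := fun f g i =>
    (β.hom.hom.map_heq ((α.map_fib (g ≫ f) i).trans (by rw [α.hom.hom.F.map_comp]))
      (α.map_fib f i) (α.map_fibMap f g i)).trans (β.map_fibMap _ _ _)
  rel_γ := fun f i k => by
    refine (β.hom.hom.rel_val (α.map_fib f i) (α.rel_γ f i k)).trans ?_
    refine (β.rel_γ _ _ _).trans ?_
    refine congrArg (fun k' => (C.γ _ _ k').val) (eps_injective _ _ ?_)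
    refine (LaxSlice.Hom.eps_relFib β.hom.hom _ _ _).trans ?_
    refine Eq.trans ?_ (LaxSlice.Hom.eps_relFib (α.hom.hom ≫ β.hom.hom) f i k).symm
    exact congrArg _ (LaxSlice.Hom.eps_relFib α.hom.hom f i k)

/-- The category `LaxOpCat` of lax-operadic categories and lax-operadic functors. -/
instance : Category.{u} LaxOpCat.{u} where
  Hom := LaxOpCat.Hom
  id := LaxOpCat.Hom.id
  comp := LaxOpCat.Hom.comp
  id_comp _ := rfl
  comp_id _ := rfl
  assoc _ _ _ := rfl

/-- The forgetful functor `LaxOpCat ⥤ Cat_ℓt // 𝓢`. -/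
def LaxOpCat.forget : LaxOpCat.{u} ⥤ LtSlice.{u} where
  obj A := A.toLtSlice
  map α := α.hom

theorem LaxOpData.eqToHom_fibreMap (A : LaxOpData.{u}) {Z Y X : A.carrier} (f : Y ⟶ X)
    (g : Z ⟶ Y) {f' : Z ⟶ X} (e : f' = g ≫ f) (i : Fin (A.abs X))
    (h : A.fibre f' i = A.fibre (g ≫ f) i) :
    eqToHom h ≫ A.fibreMap f g i =
      (A.fibreFunctor X i).map (Over.homMk g e.symm : Over.mk f' ⟶ Over.mk f) := by
  subst e
  exact Category.id_comp _

/-- The morphism `D_m (C, |-|) ⟶ (C, |-|)` given by the fibre functors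
`(X, i, f) ↦ f⁻¹(i)` and the relabelling functions of a lax-operadic category. -/
def LaxOpCat.action (A : LaxOpCat.{u}) : decObj A.toLaxSlice ⟶ A.toLaxSlice :=
  .ofRel (A := decObj A.toLaxSlice) (B := A.toLaxSlice)
    { obj := fun p => A.fibre p.hom p.idx
      map := fun {p q} a =>
        eqToHom (congrArg (fun r : DecObj A.toLaxSlice => A.fibre r.hom r.idx) (DecHom.w a)) ≫
          A.fibreMap q.hom (DecHom.left a) q.idx
      map_id := fun p => by
        refine (A.eqToHom_fibreMap p.hom (𝟙 p.src) (Category.id_comp _).symm p.idx _).trans ?_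
        exact (A.fibreFunctor p.base p.idx).map_id (Over.mk p.hom)
      map_comp := fun {p q r} a b => by
        induction b using DecHom.ind with
        | mk b =>
          induction a using DecHom.ind with
          | mk a =>
            refine (A.eqToHom_fibreMap r.hom (a ≫ b) (Category.assoc _ _ _).symm r.idx _).trans ?_
            refine Eq.trans ?_ (congrArg₂ (· ≫ ·)
              (A.eqToHom_fibreMap (b ≫ r.hom) a rfl r.idx _)
              (A.eqToHom_fibreMap r.hom b rfl r.idx _)).symm
            refine Eq.trans ?_ ((A.fibreFunctor r.base r.idx).map_comp _ _)
            rfl }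
    (fun p => A.γ p.hom p.idx)
    (fun {p q} a k => by
      induction a using DecHom.ind with
      | mk g =>
        refine Eq.trans ?_ (A.abs_fibMap q.hom g q.idx k)
        refine congrArg (fun m => A.absMap m _) (Category.id_comp _))

end OperadicDecalage

namespace OperadicDecalage

/-! ### Equality of morphisms of the lax slice -/

/-! Coalgebras. By the counit law a coalgebra structure sends `X` to some `(bX, i, h : X ⟶ bX)`, and
`f` to a map of `D_m C` lying over `f`. Maps of `D_m C` stay in one summand, so a map `f : Y ⟶ X`
forces `bY = bX` and `h_Y = f ≫ h_X` (`coalg_obj_of_hom`); thus `b` is constant on components.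
Coassociativity gives `a(bX) = (bX, i, 1)`, so `h_{bX}` is an identity (`coalg_obj_coalgBase`).
Hence any `f : X ⟶ bX` equals `f ≫ h_{bX} = h_X`, and `bX` is terminal in its component
(`coalgHom_uniq`). The counit law at `bX` makes `|bX|` a singleton (`eq_idx_coalgBase`). The index
and the 2-cell are then forced, so the structure is `LtSlice.unit` (`coalg_a_eq_unit`), and
coalgebra morphisms are the morphisms preserving chosen terminal objects.

Algebras. A morphism `D_m C ⟶ C` is a family of functors `C/X ⥤ C` with relabelling functions
natural in the slice maps. Each algebra law (`LtSlice.IsAction`) unfolds into axioms of a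
lax-operadic category. Being a coalgebra morphism says that fibres of identities are chosen. The
unit law gives the three axioms on `τ_X`. Associativity, evaluated on objects, maps and 2-cells of
`D_m D_m C`, gives the three axioms on iterated fibres. The converse `LaxOpCat.action_assoc` reads
the same equations backwards, and `LaxOpCat.comult_action` uses that an object of `D_m C` over a
chosen terminal object is a value of the unit (`LtSlice.eq_unit_obj`).

The isomorphisms are strict. The functors leave underlying morphisms unchanged, so the work is in
the equalities of objects, and heterogeneous equality absorbs the transports. -/

theorem LaxSlice.Hom.obj_congr {A B : LaxSlice.{u}} {α β : A ⟶ B} (h : α = β) (X : A.carrier) :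
    α.F.obj X = β.F.obj X := by
  rw [h]

theorem LaxSlice.Hom.map_congr {A B : LaxSlice.{u}} {α β : A ⟶ B} (h : α = β) {Y X : A.carrier}
    (f : Y ⟶ X) : HEq (α.F.map f) (β.F.map f) := by
  rw [h]

theorem LaxSlice.Hom.rel_congr {A B : LaxSlice.{u}} {α β : A ⟶ B} (h : α = β) (X : A.carrier)
    (j : Fin (A.abs X)) : (α.rel X j).val = (β.rel X j).val := by
  rw [h]

/-! ### Objects of the modified décalage -/

theorem DecObj.eq_mk_of_src_eq {A : LaxSlice.{u}} (p : DecObj A) {X : A.carrier} (h : p.src = X) :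
    p = ⟨p.base, p.idx, X, eqToHom h.symm ≫ p.hom⟩ := by
  subst h
  simp

/-- A map of `D_m C` determines its domain from its codomain and its underlying map. The underlying
map is allowed to be known only up to equality of its ends, as the counit law provides it. -/
theorem DecHom.eq_mk_of_left_heq {A : LaxSlice.{u}} {p q : DecObj A} (m : DecHom p q)
    {Y X : A.carrier} (hp : p.src = Y) (hq : q.src = X) (f : Y ⟶ X) (hf : HEq m.left f) :
    p = ⟨q.base, q.idx, Y, f ≫ eqToHom hq.symm ≫ q.hom⟩ := by
  subst hp hq
  cases hf
  simpa using m.w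

theorem DecObj.ext_val {A : LaxSlice.{u}} {p q : DecObj A} (hb : p.base = q.base)
    (hi : p.idx.val = q.idx.val) (hs : p.src = q.src) (hh : HEq p.hom q.hom) : p = q := by
  obtain ⟨b, i, s, h⟩ := p
  obtain ⟨b', i', s', h'⟩ := q
  dsimp only at hb hi hs hh
  subst hb hs
  cases Fin.ext hi
  cases hh
  rfl

theorem DecObj.base_congr {A : LaxSlice.{u}} {p q : DecObj A} (h : p = q) : p.base = q.base := by
  rw [h]

theorem DecObj.hom_congr {A : LaxSlice.{u}} {p q : DecObj A} (h : p = q) :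
    HEq p.hom q.hom := by
  rw [h]

/-! ### Coalgebras of modified décalage have local terminal objects -/

section Coalgebra

variable (A : modifiedDecalage.{u}.Coalgebra)

/-- The base of the slice summand into which the structure map sends `X`. -/
def coalgBase (X : A.A.carrier) : A.A.carrier := (A.a.F.obj X : DecObj A.A).base

theorem coalg_src (X : A.A.carrier) : (A.a.F.obj X : DecObj A.A).src = X :=
  LaxSlice.Hom.obj_congr A.counit X

/-- The map from `X` to the base of its slice summand. -/
def coalgHom (X : A.A.carrier) : X ⟶ coalgBase A X :=
  eqToHom (coalg_src A X).symm ≫ (A.a.F.obj X : DecObj A.A).hom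

theorem coalg_left {Y X : A.A.carrier} (f : Y ⟶ X) :
    HEq (DecHom.left (A.a.F.map f)) f :=
  LaxSlice.Hom.map_congr A.counit f

theorem coalg_obj (X : A.A.carrier) :
    A.a.F.obj X = (⟨coalgBase A X, (A.a.F.obj X : DecObj A.A).idx, X, coalgHom A X⟩ : DecObj A.A) :=
  DecObj.eq_mk_of_src_eq _ (coalg_src A X)

/-- The image of `f` under the structure map is a map of `D_m C` over `f`, so its domain lies in the
summand of its codomain and is obtained by precomposing with `f`. -/
theorem coalg_obj_of_hom {Y X : A.A.carrier} (f : Y ⟶ X) :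
    A.a.F.obj Y = (⟨coalgBase A X, (A.a.F.obj X : DecObj A.A).idx, Y, f ≫ coalgHom A X⟩ :
      DecObj A.A) :=
  DecHom.eq_mk_of_left_heq (A.a.F.map f) (coalg_src A Y) (coalg_src A X) f (coalg_left A f)

theorem coalgBase_of_hom {Y X : A.A.carrier} (f : Y ⟶ X) : coalgBase A Y = coalgBase A X := by
  have h := DecObj.base_congr (coalg_obj_of_hom A f)
  exact h

theorem coalgHom_of_hom {Y X : A.A.carrier} (f : Y ⟶ X) :
    HEq (coalgHom A Y) (f ≫ coalgHom A X) :=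
  DecObj.hom_congr ((coalg_obj A Y).symm.trans (coalg_obj_of_hom A f))

/-- Compare bases in the coassociativity law at `X`: the comultiplication always produces an object
over some `(bX, i, 1)`, while `D_m a` produces one over `a(bX)`. -/
theorem coalg_obj_coalgBase (X : A.A.carrier) :
    A.a.F.obj (coalgBase A X) = DecObj.one (coalgBase A X) (A.a.F.obj X : DecObj A.A).idx :=
  (DecObj.base_congr (LaxSlice.Hom.obj_congr A.coassoc X)).symm

theorem coalgBase_coalgBase (X : A.A.carrier) : coalgBase A (coalgBase A X) = coalgBase A X := by
  have h := DecObj.base_congr (coalg_obj_coalgBase A X)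
  exact h

theorem coalgHom_coalgBase (X : A.A.carrier) :
    HEq (coalgHom A (coalgBase A X)) (𝟙 (coalgBase A X)) :=
  DecObj.hom_congr ((coalg_obj A _).symm.trans (coalg_obj_coalgBase A X))

theorem eps_coalg_rel (X : A.A.carrier) (j : Fin (A.A.abs X)) :
    ((A.a.F.obj X : DecObj A.A).eps (A.a.rel X j)).val = j.val :=
  LaxSlice.Hom.rel_congr A.counit X j

/-- By the counit law every `j` in `|bX|` is a value of `ε` for `a(bX) = (bX, i, 1)`, and the only
value of that `ε` is `i`. -/
theorem eq_idx_coalgBase (X : A.A.carrier) (j : Fin (A.A.abs (coalgBase A X))) :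
    j = (A.a.F.obj X : DecObj A.A).idx := by
  -- Stated for a variable `p`, so that the equation for `a(bX)` can be substituted.
  have key : ∀ (p : DecObj A.A) (i : Fin (A.A.abs (coalgBase A X)))
      (_ : p = DecObj.one (coalgBase A X) i) (k : Fin ((decObj A.A).abs p)),
      (p.eps k).val = i.val := by
    rintro _ i rfl k
    refine congrArg Fin.val (Eq.trans ?_ (apply_eps (A.A.absMap (𝟙 _)) i k))
    exact (A.A.absMap_id _ _).symm
  exact Fin.ext ((eps_coalg_rel A _ j).symm.trans (key _ _ (coalg_obj_coalgBase A X) _))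

theorem abs_coalgBase (X : A.A.carrier) : A.A.abs (coalgBase A X) = 1 := by
  have h : Subsingleton (Fin (A.A.abs (coalgBase A X))) :=
    ⟨fun j k => (eq_idx_coalgBase A X j).trans (eq_idx_coalgBase A X k).symm⟩
  -- Nonempty because summands of `D_m C` are indexed by elements: `bX` comes with one.
  have h1 := Fin.pos ((A.a.F.obj X : DecObj A.A).idx)
  have h2 := Fin.subsingleton_iff_le_one.mp h
  exact le_antisymm h2 h1

theorem coalgHom_uniq {X : A.A.carrier} (f : X ⟶ coalgBase A X) : f = coalgHom A X := by
  -- The codomain of `h_{bX}` is `b(bX)`, which is only propositionally `bX`, so composing with this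
  -- identity is neutral only up to `HEq`.
  have key : ∀ {Z : A.A.carrier} (_ : Z = coalgBase A X) (g : coalgBase A X ⟶ Z)
      (_ : HEq g (𝟙 (coalgBase A X))), HEq (f ≫ g) f := by
    rintro _ rfl g hg
    cases hg
    simp
  exact eq_of_heq ((key (coalgBase_coalgBase A X) _ (coalgHom_coalgBase A X)).symm.trans
    (coalgHom_of_hom A f).symm)

theorem coalgBase_of_zigzag {Y X : A.A.carrier} (h : Zigzag Y X) :
    coalgBase A Y = coalgBase A X := by
  induction h with
  | refl => rfl
  | tail _ h ih =>
    refine ih.trans ?_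
    rcases h with ⟨⟨f⟩⟩ | ⟨⟨f⟩⟩
    · exact coalgBase_of_hom A f
    · exact (coalgBase_of_hom A f).symm

/-- The local terminal objects of a coalgebra of modified décalage. -/
def coalgLocalTerminals : LocalTerminals A.A.carrier where
  term := Quotient.lift (coalgBase A) (fun _ _ h => coalgBase_of_zigzag A h)
  τ := coalgHom A
  uniq := coalgHom_uniq A

/-- The object of `Cat_ℓt // 𝓢` underlying a coalgebra of modified décalage. -/
def coalgLtSlice : LtSlice.{u} where
  toLaxSlice := A.A
  lt := coalgLocalTerminals A
  abs_term := by
    rintro ⟨X⟩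
    exact abs_coalgBase A X

/-- Nothing is left to choose: `|uX|` has one element, and `ε` is injective with `ε ∘ ν` the
identity on both sides. -/
theorem coalg_a_eq_unit : A.a = (coalgLtSlice A).unit := by
  have hobj : ∀ X : A.A.carrier, A.a.F.obj X = (coalgLtSlice A).unit.F.obj X := fun X =>
    (coalg_obj A X).trans (DecObj.ext_val rfl
      (congrArg Fin.val ((coalgLtSlice A).eq_star X _)) rfl HEq.rfl)
  refine LaxSlice.Hom.ext' hobj (fun {Y X} f => ?_) (fun X j => ?_)
  · exact DecHom.hext (hobj Y) (hobj X) (coalg_left A f)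
  · refine DecObj.val_eq (hobj X) ((eps_coalg_rel A X j).trans ?_)
    exact congrArg Fin.val (eps_pos _ _ j ((coalgLtSlice A).eq_star X _)).symm

end Coalgebra

/-! ### The coalgebra structure of an object with local terminal objects -/

theorem LtSlice.eps_unit_rel (A : LtSlice.{u}) (X : A.carrier) (j : Fin (A.abs X)) :
    (A.unit.F.obj X : DecObj A.toLaxSlice).eps (A.unit.rel X j) = j :=
  eps_pos _ _ _ (A.eq_star X _)

theorem LtSlice.mk_term (A : LtSlice.{u}) (c : CategoryTheory.ConnectedComponents A.carrier) :
    CategoryTheory.ConnectedComponents.mk (A.lt.term c) = c := by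
  induction c using Quotient.ind with
  | _ X => exact Quotient.sound' (Zigzag.of_inv (A.τ X))

theorem LtSlice.one_eq_unit_obj (A : LtSlice.{u})
    (c : CategoryTheory.ConnectedComponents A.carrier) (i : Fin (A.abs (A.lt.term c))) :
    DecObj.one (A := A.toLaxSlice) (A.lt.term c) i = A.unit.F.obj (A.lt.term c) :=
  (A.unit_eq c (A.mk_term c) i (𝟙 _)).symm

/-- Turns a statement that some object is chosen into an equation with the coalgebra structure; it
serves both for morphisms of `Cat_ℓt // 𝓢` and for actions. -/
theorem LtSlice.eq_unit_obj (B : LtSlice.{u}) {Z X : B.carrier} (hZ : B.IsChosen Z)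
    (i : Fin (B.abs Z)) (g : X ⟶ Z) :
    (⟨Z, i, X, g⟩ : DecObj B.toLaxSlice) = B.unit.F.obj X := by
  obtain ⟨c, rfl⟩ := hZ
  exact (B.unit_eq c ((Quotient.sound' (Zigzag.of_hom g)).trans (B.mk_term c)) i g).symm

/-- The coalgebra of modified décalage given by local terminal objects. -/
def LtSlice.coalgebra (A : LtSlice.{u}) : modifiedDecalage.{u}.Coalgebra where
  A := A.toLaxSlice
  a := A.unit
  counit := by
    refine LaxSlice.Hom.ext' (fun X => rfl) (fun f => HEq.rfl) (fun X j => ?_)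
    exact congrArg Fin.val (A.eps_unit_rel X j)
  coassoc := by
    have hobj : ∀ X : A.carrier, (decComultFunctor A.toLaxSlice).obj (A.unit.F.obj X) =
        (decFunctor A.unit).obj (A.unit.F.obj X) := fun X => by
      refine DecObj.ext2 (A.one_eq_unit_obj _ _) ?_ rfl HEq.rfl
      refine congrArg Fin.val ((DecObj.eps_pt _ _).trans ?_)
      exact (A.eps_unit_rel _ _).symm
    refine LaxSlice.Hom.ext' hobj (fun f => DecHom.hext (hobj _) (hobj _) HEq.rfl) (fun X j => ?_)
    refine DecObj.val_eq (hobj X) ?_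
    have h1 := eps_decComult_rel (A.unit.F.obj X) (A.unit.rel X j)
    have h2 := eps_decMap_rel A.unit (A.unit.F.obj X) (A.unit.rel X j)
    rw [A.eps_unit_rel] at h2
    exact congrArg Fin.val (h1.trans h2.symm)

/-- A morphism of `Cat // 𝓢` that strictly preserves chosen local terminal objects is
compatible with the coalgebra structures. -/
theorem LtSlice.unit_comp_decMap {A B : LtSlice.{u}} (α : A.toLaxSlice ⟶ B.toLaxSlice)
    (h : ∀ X : A.carrier, A.IsChosen X → B.IsChosen (α.F.obj X)) :
    A.unit ≫ decMap α = α ≫ B.unit := by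
  have hobj : ∀ X : A.carrier, (decFunctor α).obj (A.unit.F.obj X) =
      B.unit.F.obj (α.F.obj X) := fun X =>
    B.eq_unit_obj (h (A.uObj X) ⟨_, rfl⟩) _ _
  refine LaxSlice.Hom.ext' hobj (fun f => DecHom.hext (hobj _) (hobj _) HEq.rfl) (fun X j => ?_)
  refine DecObj.val_eq (hobj X) ?_
  have h2 := eps_decMap_rel α (A.unit.F.obj X) (A.unit.rel X j)
  rw [A.eps_unit_rel] at h2
  exact congrArg Fin.val (h2.trans (B.eps_unit_rel _ _).symm)

/-- At `X`, the two sides have bases `F(uX)` and `u(FX)`. -/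
theorem LtSlice.isChosen_of_unit_comp {A B : LtSlice.{u}} (α : A.toLaxSlice ⟶ B.toLaxSlice)
    (h : A.unit ≫ decMap α = α ≫ B.unit) (X : A.carrier) (hX : A.IsChosen X) :
    B.IsChosen (α.F.obj X) := by
  obtain ⟨c, rfl⟩ := hX
  induction c using Quotient.ind with
  | _ X => exact ⟨_, DecObj.base_congr (LaxSlice.Hom.obj_congr h X)⟩

/-! ### The isomorphism between coalgebras and objects with local terminal objects -/

theorem coalg_unit_comp {A B : modifiedDecalage.{u}.Coalgebra} (α : A ⟶ B) :
    (coalgLtSlice A).unit ≫ decMap α.f = α.f ≫ (coalgLtSlice B).unit :=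
  (congrArg (· ≫ decMap α.f) (coalg_a_eq_unit A)).symm.trans
    (α.h.trans (congrArg (α.f ≫ ·) (coalg_a_eq_unit B)))

/-- The functor from coalgebras of modified décalage to `Cat_ℓt // 𝓢`. -/
def coalgToLt : modifiedDecalage.{u}.Coalgebra ⥤ LtSlice.{u} where
  obj := coalgLtSlice
  map {A B} α := LtSlice.Hom.mk (A := coalgLtSlice A) (B := coalgLtSlice B) α.f
    (LtSlice.isChosen_of_unit_comp (A := coalgLtSlice A) (B := coalgLtSlice B) α.f
      (coalg_unit_comp α))
  map_id _ := rfl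
  map_comp _ _ := rfl

/-- The functor from `Cat_ℓt // 𝓢` to coalgebras of modified décalage. -/
def ltToCoalg : LtSlice.{u} ⥤ modifiedDecalage.{u}.Coalgebra where
  obj := LtSlice.coalgebra
  map {A B} α := Comonad.Coalgebra.Hom.mk (A := A.coalgebra) (B := B.coalgebra) α.hom
    (LtSlice.unit_comp_decMap α.hom α.map_term)
  map_id _ := rfl
  map_comp _ _ := rfl

/-- Uniqueness of maps into the chosen objects determines `τ`. -/
theorem LocalTerminals.ext_term {C : Type u} [SmallCategory C] {L M : LocalTerminals C}
    (h : ∀ c, L.term c = M.term c) : L = M := by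
  obtain ⟨t, τ, uniq⟩ := L
  obtain ⟨t', τ', uniq'⟩ := M
  cases funext h
  cases (funext fun X => uniq' (τ X) : τ = τ')
  rfl

theorem LtSlice.mk_congr {A : LaxSlice.{u}} {L M : LocalTerminals A.carrier} (h : L = M)
    (hL : ∀ c, A.abs (L.term c) = 1) (hM : ∀ c, A.abs (M.term c) = 1) :
    LtSlice.mk A L hL = LtSlice.mk A M hM := by
  subst h
  rfl

theorem coalgLtSlice_coalgebra (A : LtSlice.{u}) : coalgLtSlice A.coalgebra = A :=
  LtSlice.mk_congr (LocalTerminals.ext_term (by rintro ⟨X⟩; rfl)) _ _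

theorem coalg_ext {A B : modifiedDecalage.{u}.Coalgebra} (h : A.A = B.A) (ha : HEq A.a B.a) :
    A = B := by
  obtain ⟨A, a, _, _⟩ := A
  obtain ⟨B, b, _, _⟩ := B
  cases h
  cases ha
  rfl

theorem coalgebra_coalgLtSlice (A : modifiedDecalage.{u}.Coalgebra) :
    (coalgLtSlice A).coalgebra = A :=
  coalg_ext rfl (heq_of_eq (coalg_a_eq_unit A).symm)

theorem coalg_hom_hext {A B A' B' : modifiedDecalage.{u}.Coalgebra} (hA : A = A') (hB : B = B')
    {α : A ⟶ B} {β : A' ⟶ B'} (h : HEq α.f β.f) : HEq α β := by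
  subst hA hB
  exact heq_of_eq (Comonad.Coalgebra.Hom.ext (eq_of_heq h))

theorem LtSlice.hom_hext {A B A' B' : LtSlice.{u}} (hA : A = A') (hB : B = B')
    {α : A ⟶ B} {β : A' ⟶ B'} (h : HEq (LtSlice.Hom.hom α) (LtSlice.Hom.hom β)) : HEq α β := by
  subst hA hB
  exact heq_of_eq (LtSlice.Hom.ext (eq_of_heq h))

theorem coalgToLt_comp_ltToCoalg : coalgToLt.{u} ⋙ ltToCoalg = 𝟭 _ :=
  CategoryTheory.Functor.hext coalgebra_coalgLtSlice fun A B _ =>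
    coalg_hom_hext (coalgebra_coalgLtSlice A) (coalgebra_coalgLtSlice B) HEq.rfl

theorem ltToCoalg_comp_coalgToLt : ltToCoalg.{u} ⋙ coalgToLt = 𝟭 _ :=
  CategoryTheory.Functor.hext coalgLtSlice_coalgebra fun A B _ =>
    LtSlice.hom_hext (coalgLtSlice_coalgebra A) (coalgLtSlice_coalgebra B) HEq.rfl

/-! ### Algebras of the modified décalage monad -/

section Algebra

variable (B : modifiedDecalageMonad.{u}.Algebra)

/-- The structure morphism `D_m C ⟶ C` of an algebra. -/
def algAct : decObj B.A.A ⟶ B.A.A := B.a.f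

theorem algAct_unit : B.A.a ≫ algAct B = 𝟙 B.A.A := by
  -- The unit of the adjunction arises by transposing an identity, which leaves the factor `D_m 𝟙`.
  have h : (B.A.a ≫ modifiedDecalage.map (𝟙 B.A.A)) ≫ algAct B = 𝟙 B.A.A :=
    congrArg Comonad.Coalgebra.Hom.f B.unit
  rw [modifiedDecalage.map_id] at h
  exact h

/-- The multiplication of the induced monad is `D_m` applied to the counit of the comonad. -/
theorem algAct_assoc :
    decMap (decCounit B.A.A) ≫ algAct B = decMap (algAct B) ≫ algAct B :=
  congrArg Comonad.Coalgebra.Hom.f B.assoc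

theorem algAct_coalg : decComult B.A.A ≫ decMap (algAct B) = algAct B ≫ B.A.a :=
  B.a.h

end Algebra

/-! ### Lax-operadic categories from actions of modified décalage -/

/-- A strictly monotone enumeration of a fibre is unique. Hence the identification of
`(|g|^{|f|}_i)⁻¹(j)` with `|g|⁻¹(ε j)` by `Fin.cast` respects the inclusions into the domain of
`|g|`. -/
theorem eq_eps_cast {m n l : ℕ} (φ : Fin m → Fin n) (i : Fin n) (h : l = fib φ i)
    (e : Fin l → Fin m) (he : StrictMono e) (hφ : ∀ k, φ (e k) = i) (k : Fin l) :
    e k = eps φ i (Fin.cast h k) := by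
  subst h
  exact congrFun (Finset.orderEmbOfFin_unique rfl
    (fun k => Finset.mem_filter.mpr ⟨Finset.mem_univ _, hφ k⟩) he) k

/-- The inclusion of the summand `C / X` of `D_m C` indexed by `(X, i)`. -/
def decIncl (A : LaxSlice.{u}) (X : A.carrier) (i : Fin (A.abs X)) : Over X ⥤ DecObj A where
  obj f := ⟨X, i, f.left, f.hom⟩
  map {f' f} g := ⟨g.left, by rw [Over.w g]⟩
  map_id _ := rfl
  map_comp _ _ := rfl

/-- The map `g : (X, i, fg) ⟶ (X, i, f)` of `D_m C`. -/
def DecHom.of {A : LaxSlice.{u}} {Z Y X : A.carrier} (f : Y ⟶ X) (g : Z ⟶ Y) (i : Fin (A.abs X)) :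
    (⟨X, i, Z, g ≫ f⟩ : DecObj A) ⟶ ⟨X, i, Y, f⟩ :=
  ⟨g, rfl⟩

/-- The object of `D_m D_m C` given by `j` and `g : (X, i, fg) ⟶ (X, i, f)`. -/
def DecObj.of {A : LaxSlice.{u}} {Z Y X : A.carrier} (f : Y ⟶ X) (g : Z ⟶ Y) (i : Fin (A.abs X))
    (j : Fin (fib (A.absMap f) i)) : DecObj (decObj A) :=
  ⟨⟨X, i, Y, f⟩, j, ⟨X, i, Z, g ≫ f⟩, DecHom.of f g i⟩

/-- An action of modified décalage on an object of `Cat_ℓt // 𝓢`. -/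
structure LtSlice.IsAction (A : LtSlice.{u}) (act : decObj A.toLaxSlice ⟶ A.toLaxSlice) :
    Prop where
  unit : A.unit ≫ act = 𝟙 A.toLaxSlice
  assoc : decMap (decCounit A.toLaxSlice) ≫ act = decMap act ≫ act
  coalg : decComult A.toLaxSlice ≫ decMap act = act ≫ A.unit

/-- The fibre functors and relabelling functions of a morphism `D_m C ⟶ C`. -/
def LtSlice.opData (A : LtSlice.{u}) (act : decObj A.toLaxSlice ⟶ A.toLaxSlice) : LaxOpData.{u} where
  toLtSlice := A
  fibreFunctor X i := decIncl A.toLaxSlice X i ⋙ act.F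
  relabel {Y X} f i := act.rel ⟨X, i, Y, f⟩

section

variable {A : LtSlice.{u}} {act : decObj A.toLaxSlice ⟶ A.toLaxSlice}

/-- This is naturality of the 2-cell of `act`; no law of an action is needed. -/
theorem LtSlice.opData_abs_fibMap {Z Y X : A.carrier} (f : Y ⟶ X) (g : Z ⟶ Y) (i : Fin (A.abs X))
    (k : Fin (fib (A.absMap (g ≫ f)) i)) :
    A.absMap ((A.opData act).fibreMap f g i) ((A.opData act).γ (g ≫ f) i k) =
      (A.opData act).γ f i (A.absFib f g i k) :=
  act.rel_naturality (DecHom.of f g i) k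

namespace LtSlice.IsAction

variable (h : A.IsAction act)

include h

/-- At `(X, i, 1_X)` the two sides of the coalgebra-morphism law have bases `(1_X)⁻¹(i)` and a
chosen object. -/
theorem fib_id (X : A.carrier) (i : Fin (A.abs X)) :
    A.IsChosen ((A.opData act).fibre (𝟙 X) i) :=
  ⟨_, DecObj.base_congr (LaxSlice.Hom.obj_congr h.coalg (DecObj.one X i))⟩

theorem fib_τ (X : A.carrier) : (A.opData act).fibre (A.τ X) (A.star X) = X :=
  LaxSlice.Hom.obj_congr h.unit X

theorem fibMap_τ {Y X : A.carrier} (f : Y ⟶ X) :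
    HEq ((A.opData act).fibreMap (A.τ X) f (A.star X)) f := by
  refine HEq.trans ?_ (LaxSlice.Hom.map_congr h.unit f)
  -- The unit sends `Y` to `(uY, ∗, τ_Y)`, which agrees with `(uX, ∗, f ≫ τ_X)` only
  -- propositionally.
  have hY := (DecHom.w (A.unit.F.map f)).symm
  exact act.map_heq hY rfl (DecHom.hext hY rfl HEq.rfl)

theorem γ_τ (X : A.carrier) (k : Fin (fib (A.absMap (A.τ X)) (A.star X))) :
    ((A.opData act).γ (A.τ X) (A.star X) k).val =
      (eps (A.absMap (A.τ X)) (A.star X) k).val := by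
  refine Eq.trans ?_ (LaxSlice.Hom.rel_congr h.unit X (eps (A.absMap (A.τ X)) (A.star X) k))
  refine congrArg (fun k => (act.rel (A.unit.F.obj X) k).val)
    (eps_injective (A.absMap (A.τ X)) (A.star X) ?_)
  exact (A.eps_unit_rel X _).symm

/-- On the object of `D_m D_m C` given by `g` and `j`, `D_m` of the counit yields `(Y, ε j, g)` and
`D_m` of the action yields `(f⁻¹(i), γ j, g^f_i)`; associativity equates their fibres. -/
theorem fib_fibMap {Z Y X : A.carrier} (f : Y ⟶ X) (g : Z ⟶ Y) (i : Fin (A.abs X))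
    (j : Fin (fib (A.absMap f) i)) :
    (A.opData act).fibre ((A.opData act).fibreMap f g i) ((A.opData act).γ f i j) =
      (A.opData act).fibre g (eps (A.absMap f) i j) :=
  (LaxSlice.Hom.obj_congr h.assoc (DecObj.of f g i j)).symm

theorem γ_fibMap {Z Y X : A.carrier} (f : Y ⟶ X) (g : Z ⟶ Y) (i : Fin (A.abs X))
    (j : Fin (fib (A.absMap f) i)) (k : Fin (fib (A.absFib f g i) j)) :
    ((A.opData act).γ ((A.opData act).fibreMap f g i) ((A.opData act).γ f i j)
        ((A.opData act).γbar LtSlice.opData_abs_fibMap f g i j k)).val =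
      ((A.opData act).γ g (eps (A.absMap f) i j)
        (Fin.cast (A.fib_absFib f g i j) k)).val := by
  refine (LaxSlice.Hom.rel_congr h.assoc (DecObj.of f g i j) k).symm.trans ?_
  refine congrArg (fun k => (act.rel ⟨Y, eps (A.absMap f) i j, Z, g⟩ k).val)
    (DecObj.eps_injective _ ?_)
  refine (eps_decMap_rel (decCounit A.toLaxSlice) (DecObj.of f g i j) k).trans ?_
  -- The composite of the two inclusions is strictly monotone and lands over `ε j`, so it is the
  -- standard enumeration of `|g|⁻¹(ε j)`.
  refine eq_eps_cast _ _ _ (fun k => eps (A.absMap (g ≫ f)) i (eps (A.absFib f g i) j k))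
    ((eps_strictMono _ _).comp (eps_strictMono _ _)) (fun k => ?_) k
  refine (eps_restr _ _ _ _ (A.absMap g) _ _).symm.trans
    (congrArg (eps (A.absMap f) i) (apply_eps (A.absFib f g i) j k))

theorem fibMap_fibMap {W Z Y X : A.carrier} (f : Y ⟶ X) (g : Z ⟶ Y) (k : W ⟶ Z)
    (i : Fin (A.abs X)) (j : Fin (fib (A.absMap f) i)) :
    HEq ((A.opData act).fibreMap ((A.opData act).fibreMap f g i)
        ((A.opData act).fibreMap (g ≫ f) k i) ((A.opData act).γ f i j))
      ((A.opData act).fibreMap g k (eps (A.absMap f) i j)) := by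
  refine HEq.trans ?_ (LaxSlice.Hom.map_congr h.assoc
    (DecHom.of (A := decObj A.toLaxSlice) (DecHom.of f g i) (DecHom.of (g ≫ f) k i) j)).symm
  have e := (DecHom.w ((decFunctor act).map
    (DecHom.of (A := decObj A.toLaxSlice) (DecHom.of f g i) (DecHom.of (g ≫ f) k i) j))).symm
  exact act.map_heq e rfl (DecHom.hext e rfl HEq.rfl)

end LtSlice.IsAction

end

/-- The lax-operadic category given by an action of modified décalage. -/
def LtSlice.laxOpCat (A : LtSlice.{u}) (act : decObj A.toLaxSlice ⟶ A.toLaxSlice)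
    (h : A.IsAction act) : LaxOpCat.{u} where
  toLaxOpData := A.opData act
  fib_id := h.fib_id
  abs_fibMap := LtSlice.opData_abs_fibMap
  fib_τ := h.fib_τ
  fibMap_τ := h.fibMap_τ
  γ_τ := h.γ_τ
  fib_fibMap := h.fib_fibMap
  γ_fibMap := h.γ_fibMap
  fibMap_fibMap := h.fibMap_fibMap

theorem LtSlice.action_laxOpCat (A : LtSlice.{u}) (act : decObj A.toLaxSlice ⟶ A.toLaxSlice)
    (h : A.IsAction act) : (A.laxOpCat act h).action = act := by
  refine LaxSlice.Hom.ext' (fun p => rfl) (fun {p q} a => ?_) (fun p k => rfl)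
  induction a using DecHom.ind with
  -- Once the domain is literally `(X, i, g ≫ f)`, the transport in `action` is an identity.
  | mk g => exact heq_of_eq (Category.id_comp _)

/-! ### The action of modified décalage on a lax-operadic category -/

theorem LaxOpCat.action_map_heq (L : LaxOpCat.{u}) {p q : DecObj L.toLaxSlice} (a : p ⟶ q) :
    HEq (L.action.F.map a) (L.fibreMap q.hom (DecHom.left a) q.idx) :=
  eqToHom_comp_heq _ _

theorem LaxOpCat.action_map_of (L : LaxOpCat.{u}) {Z Y X : L.carrier} (f : Y ⟶ X) (g : Z ⟶ Y)
    (i : Fin (L.abs X)) : L.action.F.map (DecHom.of f g i) = L.fibreMap f g i :=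
  Category.id_comp _

theorem LaxOpCat.fibreMap_heq (L : LaxOpCat.{u}) {Z Y Z' Y' X : L.carrier} {f : Y ⟶ X} {g : Z ⟶ Y}
    {f' : Y' ⟶ X} {g' : Z' ⟶ Y'} (i : Fin (L.abs X)) (hZ : Z = Z') (hY : Y = Y') (hf : HEq f f')
    (hg : HEq g g') : HEq (L.fibreMap f g i) (L.fibreMap f' g' i) := by
  subst hZ hY
  cases hf
  cases hg
  rfl

theorem LaxOpCat.γ_val (L : LaxOpCat.{u}) {p q : DecObj L.toLaxSlice} (h : p = q)
    {k : Fin ((decObj L.toLaxSlice).abs p)} {l : Fin ((decObj L.toLaxSlice).abs q)}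
    (hkl : (p.eps k).val = (q.eps l).val) :
    (L.γ p.hom p.idx k).val = (L.γ q.hom q.idx l).val := by
  subst h
  rw [p.eps_injective (Fin.ext hkl)]

theorem LaxOpCat.unit_action (L : LaxOpCat.{u}) : L.unit ≫ L.action = 𝟙 L.toLaxSlice := by
  refine LaxSlice.Hom.ext' L.fib_τ (fun {Y X} f => ?_) (fun X j => ?_)
  · exact (L.action_map_heq _).trans (L.fibMap_τ f)
  · exact (L.γ_τ X _).trans (congrArg Fin.val (L.eps_unit_rel X j))

theorem LaxOpCat.fibre_assoc (L : LaxOpCat.{u}) (P : DecObj (decObj L.toLaxSlice)) :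
    (decMap (decCounit L.toLaxSlice) ≫ L.action).F.obj P =
      (decMap L.action ≫ L.action).F.obj P := by
  obtain ⟨⟨X, i, Y, f⟩, j, p, m⟩ := P
  induction m using DecHom.ind with
  | mk g =>
    refine (L.fib_fibMap f g i j).symm.trans ?_
    exact congrArg (fun m => L.fibre m (L.γ f i j)) (L.action_map_of f g i).symm

theorem LaxOpCat.action_assoc (L : LaxOpCat.{u}) :
    decMap (decCounit L.toLaxSlice) ≫ L.action = decMap L.action ≫ L.action := by
  refine LaxSlice.Hom.ext' L.fibre_assoc (fun {Q P} a => ?_) (fun P k => ?_)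
  · induction a using DecHom.ind with
    | mk b =>
      obtain ⟨⟨X, i, Y, f⟩, j, p, m⟩ := P
      induction m using DecHom.ind with
      | mk g =>
        induction b using DecHom.ind with
        | mk h =>
          refine (L.action_map_heq _).trans ((L.fibMap_fibMap f g h i j).symm.trans ?_)
          refine HEq.trans ?_ (L.action_map_heq _).symm
          exact L.fibreMap_heq _ rfl rfl (heq_of_eq (L.action_map_of f g i).symm)
            (heq_of_eq (L.action_map_of (g ≫ f) h i).symm)
  · obtain ⟨⟨X, i, Y, f⟩, j, p, m⟩ := P
    induction m using DecHom.ind with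
    | mk g =>
      -- The action sends `g` to `g^f_i` preceded by an identity transport; `e` removes it so that
      -- the two relabelling functions can be compared.
      have e : (⟨L.fibre f i, L.γ f i j, L.fibre (g ≫ f) i, L.fibreMap f g i⟩ :
          DecObj L.toLaxSlice) = (decFunctor L.action).obj (DecObj.of f g i j) :=
        congrArg (DecObj.mk (A := L.toLaxSlice) (L.fibre f i) (L.γ f i j) (L.fibre (g ≫ f) i))
          (L.action_map_of f g i).symm
      refine Eq.trans ?_ ((L.γ_fibMap f g i j k).symm.trans ?_)
      · refine congrArg (fun k => (L.γ g (eps (L.absMap f) i j) k).val)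
          (eps_injective (L.absMap g) _ ?_)
        refine (eps_decMap_rel (decCounit L.toLaxSlice) (DecObj.of f g i j) k).trans ?_
        refine eq_eps_cast _ _ _ (fun k => eps (L.absMap (g ≫ f)) i (eps (L.absFib f g i) j k))
          ((eps_strictMono _ _).comp (eps_strictMono _ _)) (fun k => ?_) k
        exact (eps_restr _ _ _ _ (L.absMap g) _ _).symm.trans
          (congrArg (eps (L.absMap f) i) (apply_eps (L.absFib f g i) j k))
      · refine L.γ_val e (congrArg Fin.val ?_)
        refine (eps_restr _ _ _ _ _ _ _).trans ?_
        exact (eps_decMap_rel L.action (DecObj.of f g i j) k).symm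

/-- The left side sends `(X, i, f)` to an object over `(1_X)⁻¹(i)`. That fibre is chosen terminal,
so the object must be the unit at `f⁻¹(i)`. -/
theorem LaxOpCat.comult_action (L : LaxOpCat.{u}) :
    decComult L.toLaxSlice ≫ decMap L.action = L.action ≫ L.unit := by
  have hobj : ∀ p : DecObj L.toLaxSlice,
      (decFunctor L.action).obj ((decComultFunctor L.toLaxSlice).obj p) =
        L.unit.F.obj (L.action.F.obj p) := fun p =>
    L.eq_unit_obj (L.fib_id p.base p.idx) _ _
  refine LaxSlice.Hom.ext' hobj (fun f => DecHom.hext (hobj _) (hobj _) HEq.rfl) (fun p k => ?_)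
  refine DecObj.val_eq (hobj p) ?_
  have h := eps_decMap_rel L.action ((decComultFunctor L.toLaxSlice).obj p)
    ((decComult L.toLaxSlice).rel p k)
  rw [eps_decComult_rel p k] at h
  exact congrArg Fin.val (h.trans (L.eps_unit_rel _ _).symm)

/-! ### Recovering a lax-operadic category from its action -/

theorem LaxOpData.mk_congr {A : LtSlice.{u}}
    {F G : ∀ (X : A.carrier) (_ : Fin (A.abs X)), Over X ⥤ A.carrier}
    {r : ∀ {Y X : A.carrier} (f : Y ⟶ X) (i : Fin (A.abs X)),
      Fin (fib (A.absMap f) i) → Fin (A.abs ((F X i).obj (Over.mk f)))}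
    {s : ∀ {Y X : A.carrier} (f : Y ⟶ X) (i : Fin (A.abs X)),
      Fin (fib (A.absMap f) i) → Fin (A.abs ((G X i).obj (Over.mk f)))}
    (hF : ∀ X i, F X i = G X i)
    (hr : ∀ {Y X : A.carrier} (f : Y ⟶ X) (i : Fin (A.abs X)) (k : Fin (fib (A.absMap f) i)),
      (r f i k).val = (s f i k).val) :
    LaxOpData.mk A F r = LaxOpData.mk A G s := by
  cases (funext fun X => funext (hF X) : F = G)
  congr 1
  funext Y X f i k
  exact Fin.ext (hr f i k)

theorem LaxOpCat.opData_action (L : LaxOpCat.{u}) :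
    L.toLtSlice.opData L.action = L.toLaxOpData := by
  refine LaxOpData.mk_congr (fun X i => ?_) (fun _ _ _ => rfl)
  exact CategoryTheory.Functor.hext (fun _ => rfl) fun U V g => heq_of_eq
    (L.eqToHom_fibreMap V.hom g.left (Over.w g).symm i _)

theorem LaxOpCat.ext_data {L M : LaxOpCat.{u}} (h : L.toLaxOpData = M.toLaxOpData) : L = M := by
  cases L
  cases M
  cases h
  rfl

theorem LtSlice.opData_congr {A B : LtSlice.{u}} (h : A = B)
    {a : decObj A.toLaxSlice ⟶ A.toLaxSlice} {b : decObj B.toLaxSlice ⟶ B.toLaxSlice}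
    (ha : HEq a b) : A.opData a = B.opData b := by
  subst h
  rw [eq_of_heq ha]

/-- A lax-operadic category is determined by its underlying object and its action. -/
theorem LaxOpCat.ext_action {L M : LaxOpCat.{u}} (h : L.toLtSlice = M.toLtSlice)
    (ha : HEq L.action M.action) : L = M :=
  LaxOpCat.ext_data (L.opData_action.symm.trans
    ((LtSlice.opData_congr h ha).trans M.opData_action))

/-! ### Lax-operadic functors and actions -/

/-- A morphism of `Cat_ℓt // 𝓢` compatible with actions is a lax-operadic functor. -/
def LtSlice.laxOpHom {A B : LtSlice.{u}} {a : decObj A.toLaxSlice ⟶ A.toLaxSlice}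
    {b : decObj B.toLaxSlice ⟶ B.toLaxSlice} (ha : A.IsAction a) (hb : B.IsAction b) (α : A ⟶ B)
    (h : decMap α.hom ≫ b = a ≫ α.hom) : A.laxOpCat a ha ⟶ B.laxOpCat b hb :=
  LaxOpCat.Hom.mk (A := A.laxOpCat a ha) (B := B.laxOpCat b hb) α
    -- The three clauses are the components of `h` on objects, on maps and on 2-cells.
    (fun {Y X} f i => (LaxSlice.Hom.obj_congr h ⟨X, i, Y, f⟩).symm)
    (fun {Z Y X} f g i => by
      refine (LaxSlice.Hom.map_congr h (DecHom.of f g i)).symm.trans ?_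
      have e := DecHom.w ((decFunctor α.hom).map (DecHom.of f g i))
      exact b.map_heq e rfl (DecHom.hext e rfl HEq.rfl))
    (fun {Y X} f i k => (LaxSlice.Hom.rel_congr h ⟨X, i, Y, f⟩ k).symm)

/-- A lax-operadic functor is compatible with actions. -/
theorem LaxOpCat.decMap_action {L M : LaxOpCat.{u}} (α : L ⟶ M) :
    decMap (LaxOpCat.Hom.hom α).hom ≫ M.action = L.action ≫ (LaxOpCat.Hom.hom α).hom := by
  have hobj : ∀ p : DecObj L.toLaxSlice, M.action.F.obj ((decFunctor α.hom.hom).obj p) =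
      α.hom.hom.F.obj (L.action.F.obj p) := fun p => (α.map_fib p.hom p.idx).symm
  refine LaxSlice.Hom.ext' hobj (fun {p q} a => ?_) (fun p k => ?_)
  · induction a using DecHom.ind with
    | mk g =>
      refine (M.action_map_heq _).trans ((α.map_fibMap q.hom g q.idx).symm.trans ?_)
      exact α.hom.hom.map_heq rfl rfl (heq_of_eq (L.action_map_of q.hom g q.idx).symm)
  · exact (α.rel_γ p.hom p.idx k).symm

theorem LaxOpCat.hom_hext {L M L' M' : LaxOpCat.{u}} (hL : L = L') (hM : M = M')
    {α : L ⟶ M} {β : L' ⟶ M'}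
    (h : HEq (LaxOpCat.Hom.hom α).hom (LaxOpCat.Hom.hom β).hom) : HEq α β := by
  subst hL hM
  exact heq_of_eq (LaxOpCat.Hom.ext (LtSlice.Hom.ext (eq_of_heq h)))

/-! ### The isomorphism between algebras and lax-operadic categories -/

theorem algAct_isAction (B : modifiedDecalageMonad.{u}.Algebra) :
    (coalgLtSlice B.A).IsAction (algAct B) where
  unit := by
    rw [← coalg_a_eq_unit]
    exact algAct_unit B
  assoc := algAct_assoc B
  coalg := by
    rw [← coalg_a_eq_unit]
    exact algAct_coalg B

/-- The functor from algebras of the modified décalage monad to lax-operadic categories. -/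
def algToLaxOp : modifiedDecalageMonad.{u}.Algebra ⥤ LaxOpCat.{u} where
  obj B := (coalgLtSlice B.A).laxOpCat (algAct B) (algAct_isAction B)
  map {B C} β := LtSlice.laxOpHom (algAct_isAction B) (algAct_isAction C) (coalgToLt.map β.f)
    (congrArg Comonad.Coalgebra.Hom.f β.h)
  map_id _ := rfl
  map_comp _ _ := rfl

/-- The algebra of the modified décalage monad given by a lax-operadic category. -/
def LaxOpCat.algebra (L : LaxOpCat.{u}) : modifiedDecalageMonad.{u}.Algebra where
  A := L.toLtSlice.coalgebra
  a := Comonad.Coalgebra.Hom.mk (B := L.toLtSlice.coalgebra) L.action L.comult_action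
  unit := Comonad.Coalgebra.Hom.ext (by
    refine Eq.trans ?_ L.unit_action
    exact congrArg (fun m => (L.unit ≫ m) ≫ L.action) (modifiedDecalage.map_id L.toLaxSlice))
  assoc := Comonad.Coalgebra.Hom.ext L.action_assoc

/-- The functor from lax-operadic categories to algebras of the modified décalage monad. -/
def laxOpToAlg : LaxOpCat.{u} ⥤ modifiedDecalageMonad.{u}.Algebra where
  obj := LaxOpCat.algebra
  map {L M} α := Monad.Algebra.Hom.mk (A := L.algebra) (B := M.algebra)
    (ltToCoalg.map (LaxOpCat.Hom.hom α)) (Comonad.Coalgebra.Hom.ext (L.decMap_action α))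
  map_id _ := rfl
  map_comp _ _ := rfl

theorem alg_ext {B C : modifiedDecalageMonad.{u}.Algebra} (h : B.A = C.A)
    (ha : HEq (algAct B) (algAct C)) : B = C := by
  obtain ⟨A, a, _, _⟩ := B
  obtain ⟨A', a', _, _⟩ := C
  dsimp only at h
  subst h
  cases Comonad.Coalgebra.Hom.ext (eq_of_heq ha)
  rfl

theorem alg_hom_hext {B C B' C' : modifiedDecalageMonad.{u}.Algebra} (hB : B = B') (hC : C = C')
    {α : B ⟶ C} {β : B' ⟶ C'} (h : HEq α.f.f β.f.f) : HEq α β := by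
  subst hB hC
  exact heq_of_eq (Monad.Algebra.Hom.ext (Comonad.Coalgebra.Hom.ext (eq_of_heq h)))

theorem algebra_algToLaxOp (B : modifiedDecalageMonad.{u}.Algebra) :
    (algToLaxOp.obj B).algebra = B :=
  alg_ext (coalgebra_coalgLtSlice B.A) (heq_of_eq (LtSlice.action_laxOpCat _ _ (algAct_isAction B)))

/-- The local terminal objects are recovered only up to propositional equality, so the comparison
goes through the underlying object and the action. -/
theorem algToLaxOp_algebra (L : LaxOpCat.{u}) : algToLaxOp.obj L.algebra = L :=
  LaxOpCat.ext_action (coalgLtSlice_coalgebra L.toLtSlice)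
    (heq_of_eq (LtSlice.action_laxOpCat _ _ (algAct_isAction L.algebra)))

theorem algToLaxOp_comp_laxOpToAlg : algToLaxOp.{u} ⋙ laxOpToAlg = 𝟭 _ :=
  CategoryTheory.Functor.hext algebra_algToLaxOp fun B C _ =>
    alg_hom_hext (algebra_algToLaxOp B) (algebra_algToLaxOp C) HEq.rfl

theorem laxOpToAlg_comp_algToLaxOp : laxOpToAlg.{u} ⋙ algToLaxOp = 𝟭 _ :=
  CategoryTheory.Functor.hext algToLaxOp_algebra fun L M _ =>
    LaxOpCat.hom_hext (algToLaxOp_algebra L) (algToLaxOp_algebra M) HEq.rfl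

end OperadicDecalage

theorem theorem2 :
    -- the identification of `D_m`-coalgebras in `Cat // 𝓢` with objects of `Cat_ℓt // 𝓢`
    ∃ (E : OperadicDecalage.modifiedDecalage.{u}.Coalgebra ⥤ OperadicDecalage.LtSlice.{u})
      (E' : OperadicDecalage.LtSlice.{u} ⥤ OperadicDecalage.modifiedDecalage.{u}.Coalgebra),
      E ⋙ E' = 𝟭 _ ∧ E' ⋙ E = 𝟭 _ ∧
      E ⋙ OperadicDecalage.LtSlice.forget = OperadicDecalage.modifiedDecalage.forget ∧
      (∀ A : OperadicDecalage.modifiedDecalage.{u}.Coalgebra,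
        Arrow.mk A.a = Arrow.mk (E.obj A).unit) ∧
      -- the isomorphism, over this identification, of `D̃_m`-algebras with lax-operadic categories
      ∃ (K : OperadicDecalage.modifiedDecalageMonad.{u}.Algebra ⥤ OperadicDecalage.LaxOpCat.{u})
        (K' : OperadicDecalage.LaxOpCat.{u} ⥤ OperadicDecalage.modifiedDecalageMonad.{u}.Algebra),
        K ⋙ K' = 𝟭 _ ∧ K' ⋙ K = 𝟭 _ ∧
        K ⋙ OperadicDecalage.LaxOpCat.forget =
          OperadicDecalage.modifiedDecalageMonad.forget ⋙ E ∧
        ∀ B : OperadicDecalage.modifiedDecalageMonad.{u}.Algebra,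
          Arrow.mk B.a.f = Arrow.mk (K.obj B).action := by
  -- Both compatibilities with forgetful functors hold by `rfl`, as the comparison functors keep the
  -- underlying objects and morphisms.
  refine ⟨OperadicDecalage.coalgToLt, OperadicDecalage.ltToCoalg,
    OperadicDecalage.coalgToLt_comp_ltToCoalg, OperadicDecalage.ltToCoalg_comp_coalgToLt, rfl,
    fun A => congrArg Arrow.mk (OperadicDecalage.coalg_a_eq_unit A),
    OperadicDecalage.algToLaxOp, OperadicDecalage.laxOpToAlg,
    OperadicDecalage.algToLaxOp_comp_laxOpToAlg, OperadicDecalage.laxOpToAlg_comp_algToLaxOp, rfl,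
    fun B => ?_⟩
  exact congrArg Arrow.mk
    (OperadicDecalage.LtSlice.action_laxOpCat _ _ (OperadicDecalage.algAct_isAction B)).symm
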